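/- Let $G \rightrightarrows M$ be a Lie groupoid (source and target are submersions) and let $V = V_1 \oplus V_0 \to M$ be a graded real smooth vector bundle of finite rank. For $x \in M$ write $V_i^x$ for the fibre of $V_i$; an arrow $g : x \to y$ is written $y \xleftarrow{g} x$. All manifolds are finite dimensional and without boundary. **Representations up to homotopy.** A (2-term) representation up to homotopy of $G$ on $V$ is a tuple $(\partial, \rho_1, \rho_0, \gamma)$ consisting of a vector bundle map $\partial : V_1 \to V_0$ over $M$; smooth maps $\rho_i : G \times_M V_i \to V_i$, given by linear maps $\rho_i^g : V_i^x \to V_i^y$ for $y \xleftarrow{g} x$, with $\rho_i^{\mathrm{id}} = \mathrm{id}$ and $\rho_0^g\partial = \partial\rho_1^g$; and a smooth tensor $\gamma$ assigning to each pair of composable arrows $z \xleftarrow{h} y \xleftarrow{g} x$ a linear map $\gamma^{h,g} : V_0^x \to V_1^z$ such that $$\gamma^{h,g}\partial = \rho_1^{hg} - \rho_1^h\rho_1^g, \qquad \partial\gamma^{h,g} = \rho_0^{hg} - \rho_0^h\rho_0^g,$$ $$\rho_1^{g_3}\gamma^{g_2,g_1} - \gamma^{g_3g_2,g_1} + \gamma^{g_3,g_2g_1}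 - \gamma^{g_3,g_2}\rho_0^{g_1} = 0 .$$ A quasi-isomorphism $(\partial,\rho,\gamma) \to (\partial',\rho',\gamma')$ is a triple $(\theta_1,\theta_0,\mu)$ where $\theta_i : V_i \to V_i$ are vector bundle maps over $M$ with $\theta_0\partial = \partial'\theta_1$ which induce, at each $x \in M$, isomorphisms $\ker\partial^x \to \ker\partial'^x$ and $\operatorname{coker}\partial^x \to \operatorname{coker}\partial'^x$, and $\mu$ is a smooth tensor assigning to each $y \xleftarrow{g} x$ a linear map $\mu^g : V_0^x \to V_1^y$ such that $$\mu^g\partial = \theta_1\rho_1^g - \rho_1'^g\theta_1, \qquad \partial'\mu^g = \theta_0\rho_0^g - \rho_0'^g\theta_0,$$ $$\theta_1\gamma^{h,g} + \mu^h\rho_0^g + \rho_1'^h\mu^g - \mu^{hg} - \gamma'^{h,g}\theta_0 = 0 .$$ Composition is $(\theta',\mu')\circ(\theta,\mu) = (\theta'\theta,\ \theta_1'\mu + \mu'\theta_0)$. **The general linear 2-groupoid.** $GL(V)$ is the following 2-category. Its objects are the linear maps $\partial^x : V_1^x \to V_0^x$, $x \in M$. Its arrows $\partial^x \to \partial^y$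 are the pairs $\alpha = (\alpha_1,\alpha_0)$ of linear maps $\alpha_i : V_i^x \to V_i^y$ with $\alpha_0\partial^x = \partial^y\alpha_1$ that are quasi-isomorphisms. Its 2-cells $\alpha \Rightarrow \alpha'$ are the linear maps $R : V_0^x \to V_1^y$ with $R\partial^x = \alpha_1 - \alpha_1'$ and $\partial^y R = \alpha_0 - \alpha_0'$. Horizontal composition is composition of maps and vertical composition is the sum of the maps $R$. Its objects form the total space of the bundle $[V_1,V_0] \to M$ of linear maps. With $\pi_1,\pi_2 : M\times M \to M$ the projections, its arrows form an embedded submanifold of the total space of the vector bundle $[\pi_1^*V_1,\pi_1^*V_0]\oplus[\pi_2^*V_1,\pi_2^*V_0]\oplus[\pi_1^*V_1,\pi_2^*V_1]\oplus[\pi_1^*V_0,\pi_2^*V_0]$ over $M\times M$, and its 2-cells form the manifold $GL(V)_2 = GL(V)_1\times_{M\times M}[\pi_1^*V_0,\pi_2^*V_1]$, where a 2-cell $R:\alpha\Rightarrow\alpha'$ is identified with $(\alpha,R)$. Let $\pi_V : GL(V) \to \mathrm{Pair}(M)$ be the projection remembering only base points, and $\pi_G : G \to \mathrm{Pair}(M)$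 the one remembering only source and target. **Pseudo-functors.** View $G$ as a 2-category with only identity 2-cells. A smooth pseudo-functor $\phi : G \dashrightarrow GL(V)$ is a normal (strictly unitary) pseudo-functor, with invertible structure 2-cells $\phi(h,g) : \phi(hg) \Rightarrow \phi(h)\phi(g)$, such that the maps $M \to GL(V)_0$, $x \mapsto \phi(x)$; $G \to GL(V)_1$, $g \mapsto \phi(g)$; and $G\times_M G \to N_2GL(V)$, $(h,g)\mapsto(\phi(h),\phi(g),\phi(h,g))$, are smooth, where $N_2GL(V)$ is the manifold of triples formed by two composable arrows and a 2-cell with target their composite. A smooth lax equivalence $H : \phi\Rightarrow\psi$ is a lax transformation, with components $H_x : \phi(x)\to\psi(x)$ and $H_g : H_y\phi(g)\Rightarrow\psi(g)H_x$ for $y \xleftarrow{g} x$, such that each $H_g$ is invertible, each $H_x$ is invertible up to 2-cells, and the maps $M \to GL(V)_1$ and $G\to GL(V)_2$ given by $H$ are smooth. **Theorem.** The category of representations up to homotopy of $G$ on $V$ and quasi-isomorphisms is equivalent to the category of smooth pseudo-functors $\phi : G \dashrightarrow GL(V)$ satisfying $\pi_V\phi = \pi_G$ and smooth lax equivalences.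 -/

import Mathlib

set_option linter.unusedSectionVars false
set_option synthInstance.maxSize 1024
set_option synthInstance.maxHeartbeats 200000

open Bundle Manifold ContDiff CategoryTheory Topology

/-! ### Two-term complexes, quasi-isomorphisms, chain homotopies -/

/-- A chain map `(α₁, α₀)` between two-term complexes `d : A₁ → A₀` and `d' : B₁ → B₀` is a
quasi-isomorphism if the maps it induces on the homologies `H₁ = ker` and `H₀ = coker` are
bijective. -/
structure IsQuasiIso {A₁ A₀ B₁ B₀ : Type*}
    [AddCommGroup A₁] [Module ℝ A₁] [TopologicalSpace A₁]
    [AddCommGroup A₀] [Module ℝ A₀] [TopologicalSpace A₀]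
    [AddCommGroup B₁] [Module ℝ B₁] [TopologicalSpace B₁]
    [AddCommGroup B₀] [Module ℝ B₀] [TopologicalSpace B₀]
    (d : A₁ →L[ℝ] A₀) (d' : B₁ →L[ℝ] B₀) (α₁ : A₁ →L[ℝ] B₁) (α₀ : A₀ →L[ℝ] B₀)
    (comm : ∀ v, α₀ (d v) = d' (α₁ v)) : Prop where
  /-- the induced map `ker d → ker d'` is bijective -/
  bijective_ker : Function.Bijective
    (((α₁ : A₁ →ₗ[ℝ] B₁).restrict (p := LinearMap.ker (d : A₁ →ₗ[ℝ] A₀))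
      (q := LinearMap.ker (d' : B₁ →ₗ[ℝ] B₀)) (fun v hv => by
        have h : d v = 0 := hv
        change d' (α₁ v) = 0
        rw [← comm, h, map_zero])))
  /-- the induced map `coker d → coker d'` is bijective -/
  bijective_coker : Function.Bijective
    (Submodule.mapQ (LinearMap.range (d : A₁ →ₗ[ℝ] A₀)) (LinearMap.range (d' : B₁ →ₗ[ℝ] B₀))
      (α₀ : A₀ →ₗ[ℝ] B₀) (by
        rintro _ ⟨v, rfl⟩
        exact ⟨α₁ v, (comm v).symm⟩))

namespace IsQuasiIso

variable {A₁ A₀ B₁ B₀ C₁ C₀ : Type*}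
    [AddCommGroup A₁] [Module ℝ A₁] [TopologicalSpace A₁]
    [AddCommGroup A₀] [Module ℝ A₀] [TopologicalSpace A₀]
    [AddCommGroup B₁] [Module ℝ B₁] [TopologicalSpace B₁]
    [AddCommGroup B₀] [Module ℝ B₀] [TopologicalSpace B₀]
    [AddCommGroup C₁] [Module ℝ C₁] [TopologicalSpace C₁]
    [AddCommGroup C₀] [Module ℝ C₀] [TopologicalSpace C₀]

theorem refl (d : A₁ →L[ℝ] A₀) :
    IsQuasiIso d d (ContinuousLinearMap.id ℝ A₁) (ContinuousLinearMap.id ℝ A₀)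
      (fun _ => rfl) where
  bijective_ker := by
    constructor
    · intro v w h
      exact Subtype.ext (congrArg Subtype.val h)
    · intro v
      exact ⟨v, Subtype.ext rfl⟩
  bijective_coker := by
    convert Function.bijective_id
    funext x
    induction x using Submodule.Quotient.induction_on with
    | _ x => rfl

theorem comp {d : A₁ →L[ℝ] A₀} {d' : B₁ →L[ℝ] B₀} {d'' : C₁ →L[ℝ] C₀}
    {α₁ : A₁ →L[ℝ] B₁} {α₀ : A₀ →L[ℝ] B₀} {β₁ : B₁ →L[ℝ] C₁} {β₀ : B₀ →L[ℝ] C₀}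
    {hα : ∀ v, α₀ (d v) = d' (α₁ v)} {hβ : ∀ v, β₀ (d' v) = d'' (β₁ v)}
    (h : IsQuasiIso d' d'' β₁ β₀ hβ) (h' : IsQuasiIso d d' α₁ α₀ hα) :
    IsQuasiIso d d'' (β₁.comp α₁) (β₀.comp α₀)
      (fun v => by simp [hα, hβ]) where
  bijective_ker := by
    exact h.bijective_ker.comp h'.bijective_ker
  bijective_coker := by
    convert h.bijective_coker.comp h'.bijective_coker using 1
    funext x
    induction x using Submodule.Quotient.induction_on with
    | _ x => rfl

end IsQuasiIso

/-! ### The general linear 2-groupoid of a 2-term graded vector bundle -/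

section GeneralLinear

variable {M : Type*}
  (V₁ : M → Type*) [∀ x, AddCommGroup (V₁ x)] [∀ x, Module ℝ (V₁ x)]
  [∀ x, TopologicalSpace (V₁ x)]
  (V₀ : M → Type*) [∀ x, AddCommGroup (V₀ x)] [∀ x, Module ℝ (V₀ x)]
  [∀ x, TopologicalSpace (V₀ x)]

/-- Objects of `GL(V)`: a differential `d : V₁ˣ → V₀ˣ` on the fibre of `V = V₁ ⊕ V₀` over a
point `x = base`. (On the finite dimensional fibres of a vector bundle every linear map is
continuous.) -/
structure GLObj where
  base : M
  d : V₁ base →L[ℝ] V₀ base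

variable {V₁ V₀}

/-- Arrows of `GL(V)`: quasi-isomorphisms between fibres. -/
structure GLHom (a b : GLObj V₁ V₀) where
  f₁ : V₁ a.base →L[ℝ] V₁ b.base
  f₀ : V₀ a.base →L[ℝ] V₀ b.base
  comm : ∀ v, f₀ (a.d v) = b.d (f₁ v)
  quasiIso : IsQuasiIso a.d b.d f₁ f₀ comm

/-- 2-cells `α ⇒ β` of `GL(V)`: chain homotopies, given by `R : V₀ˣ → V₁ʸ` with
`R d = α₁ - β₁` and `d R = α₀ - β₀`. -/
structure GLCell {a b : GLObj V₁ V₀} (α β : GLHom a b) where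
  R : V₀ a.base →L[ℝ] V₁ b.base
  R_d : ∀ v, R (a.d v) = α.f₁ v - β.f₁ v
  d_R : ∀ w, b.d (R w) = α.f₀ w - β.f₀ w

namespace GLHom

@[ext]
theorem ext {a b : GLObj V₁ V₀} {α β : GLHom a b} (h₁ : α.f₁ = β.f₁) (h₀ : α.f₀ = β.f₀) :
    α = β := by
  cases α; cases β; cases h₁; cases h₀; rfl

/-- Identity arrows. -/
def refl (a : GLObj V₁ V₀) : GLHom a a where
  f₁ := ContinuousLinearMap.id ℝ _
  f₀ := ContinuousLinearMap.id ℝ _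
  comm _ := rfl
  quasiIso := IsQuasiIso.refl _

/-- Composition of arrows: composition of linear maps (first `α`, then `β`). -/
def trans {a b c : GLObj V₁ V₀} (α : GLHom a b) (β : GLHom b c) : GLHom a c where
  f₁ := β.f₁.comp α.f₁
  f₀ := β.f₀.comp α.f₀
  comm v := by simp [α.comm, β.comm]
  quasiIso := β.quasiIso.comp α.quasiIso

end GLHom

theorem GLCell.ext_R {a b : GLObj V₁ V₀} {α β : GLHom a b} {S T : GLCell α β}
    (h : S.R = T.R) : S = T := by
  cases S; cases T; cases h; rfl

variable [∀ x, IsTopologicalAddGroup (V₁ x)]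

namespace GLCell

/-- Identity 2-cells, more generally the zero homotopy between equal arrows. -/
def ofEq {a b : GLObj V₁ V₀} {α β : GLHom a b} (h : α = β) : GLCell α β where
  R := 0
  R_d v := by simp [h]
  d_R v := by simp [h]

/-- Vertical composition `•`: the sum of homotopies. -/
def vcomp {a b : GLObj V₁ V₀} {α β γ : GLHom a b} (S : GLCell α β) (T : GLCell β γ) :
    GLCell α γ where
  R := S.R + T.R
  R_d v := by simp [S.R_d, T.R_d]
  d_R v := by simp [S.d_R, T.d_R]

/-- Horizontal composition with an identity: precomposition with an arrow. -/
def whiskerLeft {a b c : GLObj V₁ V₀} (α : GLHom a b) {β γ : GLHom b c} (S : GLCell β γ) :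
    GLCell (α.trans β) (α.trans γ) where
  R := S.R.comp α.f₀
  R_d v := by simp [α.comm, S.R_d, GLHom.trans]
  d_R v := by simp [S.d_R, GLHom.trans]

/-- Horizontal composition with an identity: postcomposition with an arrow. -/
def whiskerRight {a b c : GLObj V₁ V₀} {α β : GLHom a b} (S : GLCell α β) (γ : GLHom b c) :
    GLCell (α.trans γ) (β.trans γ) where
  R := γ.f₁.comp S.R
  R_d v := by simp [S.R_d, GLHom.trans]
  d_R v := by simp [S.d_R, ← γ.comm, GLHom.trans]

end GLCell

/-- The arrows and 2-cells of `GL(V)` between two fixed objects form a category. -/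
instance GLHom.category (a b : GLObj V₁ V₀) : Category (GLHom a b) where
  Hom α β := GLCell α β
  id α := GLCell.ofEq rfl
  comp S T := S.vcomp T
  id_comp S := GLCell.ext_R (by simp [GLCell.vcomp, GLCell.ofEq])
  comp_id S := GLCell.ext_R (by simp [GLCell.vcomp, GLCell.ofEq])
  assoc S T U := GLCell.ext_R (by simp [GLCell.vcomp, add_assoc])

/-- The invertible 2-cell between equal arrows. -/
def GLHom.isoOfEq {a b : GLObj V₁ V₀} {α β : GLHom a b} (h : α = β) : α ≅ β where
  hom := GLCell.ofEq h
  inv := GLCell.ofEq h.symm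
  hom_inv_id := GLCell.ext_R (add_zero 0)
  inv_hom_id := GLCell.ext_R (add_zero 0)

/-- The general linear 2-groupoid `GL(V)` as a 2-category. Composition of arrows is strictly
associative and unital; the associators and unitors are identity 2-cells. Note that `α ≫ β` is
the composite usually written `β ∘ α`. -/
instance GLObj.bicategory : Bicategory (GLObj V₁ V₀) where
  Hom a b := GLHom a b
  id a := GLHom.refl a
  comp α β := α.trans β
  homCategory a b := GLHom.category a b
  whiskerLeft α _ _ S := GLCell.whiskerLeft α S
  whiskerRight S γ := GLCell.whiskerRight S γ
  associator α β γ := GLHom.isoOfEq (α := (α.trans β).trans γ) (β := α.trans (β.trans γ)) rfl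
  leftUnitor α := GLHom.isoOfEq (α := (GLHom.refl _).trans α) rfl
  rightUnitor α := GLHom.isoOfEq (α := α.trans (GLHom.refl _)) rfl
  whiskerLeft_id _ _ := GLCell.ext_R (ContinuousLinearMap.zero_comp _)
  whiskerLeft_comp _ _ _ _ _ _ := GLCell.ext_R (ContinuousLinearMap.add_comp _ _ _)
  id_whiskerLeft S := GLCell.ext_R (by
    change S.R.comp (ContinuousLinearMap.id ℝ _) = 0 + (S.R + 0)
    simp)
  comp_whiskerLeft α β _ _ S := GLCell.ext_R (by
    change S.R.comp (β.f₀.comp α.f₀) = 0 + ((S.R.comp β.f₀).comp α.f₀ + 0)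
    rw [zero_add, add_zero, ContinuousLinearMap.comp_assoc])
  id_whiskerRight _ _ := GLCell.ext_R (ContinuousLinearMap.comp_zero _)
  comp_whiskerRight _ _ _ := GLCell.ext_R (ContinuousLinearMap.comp_add _ _ _)
  whiskerRight_id S := GLCell.ext_R (by
    change (ContinuousLinearMap.id ℝ _).comp S.R = 0 + (S.R + 0)
    simp)
  whiskerRight_comp S β γ := GLCell.ext_R (by
    change (γ.f₁.comp β.f₁).comp S.R = 0 + (γ.f₁.comp (β.f₁.comp S.R) + 0)
    rw [zero_add, add_zero, ContinuousLinearMap.comp_assoc])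
  whisker_assoc α _ _ S γ := GLCell.ext_R (by
    change γ.f₁.comp (S.R.comp α.f₀) = 0 + ((γ.f₁.comp S.R).comp α.f₀ + 0)
    rw [zero_add, add_zero, ContinuousLinearMap.comp_assoc])
  whisker_exchange {a b c f g h i} S T := GLCell.ext_R (by
    change T.R.comp f.f₀ + i.f₁.comp S.R = h.f₁.comp S.R + T.R.comp g.f₀
    ext w
    have h1 := T.R_d (S.R w)
    rw [S.d_R, map_sub] at h1
    exact sub_eq_sub_iff_add_eq_add.mp h1)
  pentagon _ _ _ _ := GLCell.ext_R (by
    change ((_ : _ →L[ℝ] _).comp 0) + (0 + (0 : _ →L[ℝ] _).comp _) = 0 + 0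
    simp)
  triangle _ _ := GLCell.ext_R (by
    change 0 + (0 : _ →L[ℝ] _).comp _ = (_ : _ →L[ℝ] _).comp 0
    simp)

end GeneralLinear

/-! ### Smooth maps on subspaces of manifolds -/

section SmoothAlong

variable {EN HN N EP HP P EQ HQ Q : Type*}
  [NormedAddCommGroup EN] [NormedSpace ℝ EN] [TopologicalSpace HN]
  [TopologicalSpace N] [ChartedSpace HN N]
  [NormedAddCommGroup EP] [NormedSpace ℝ EP] [TopologicalSpace HP]
  [TopologicalSpace P] [ChartedSpace HP P]
  [NormedAddCommGroup EQ] [NormedSpace ℝ EQ] [TopologicalSpace HQ]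
  [TopologicalSpace Q] [ChartedSpace HQ Q]

/-- Let `ι : X → N` be an injective map into a manifold, by which `X` is regarded as a subset of
`N`. A map `f` from `X` to a manifold is smooth if, near every point of `X`, it is the restriction
of a smooth map defined on an open subset of `N`. When `X` is an embedded submanifold of `N`
this is smoothness for its submanifold structure. -/
def SmoothAlong (I : ModelWithCorners ℝ EN HN) (J : ModelWithCorners ℝ EP HP) {X : Type*}
    (ι : X → N) (f : X → P) : Prop :=
  ∀ x : X, ∃ (U : Set N) (g : N → P), IsOpen U ∧ ι x ∈ U ∧ ContMDiffOn I J ∞ g U ∧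
    ∀ y : X, ι y ∈ U → g (ι y) = f y

variable {I : ModelWithCorners ℝ EN HN} {J : ModelWithCorners ℝ EP HP}
  {K : ModelWithCorners ℝ EQ HQ} {X Y : Type*}

namespace SmoothAlong

theorem of_contMDiff (ι : X → N) {g : N → P} (hg : ContMDiff I J ∞ g) :
    SmoothAlong I J ι (fun x => g (ι x)) :=
  fun _ => ⟨Set.univ, g, isOpen_univ, trivial, hg.contMDiffOn, fun _ _ => rfl⟩

theorem postcomp {ι : X → N} {f : X → P} (hf : SmoothAlong I J ι f) {h : P → Q}
    (hh : ContMDiff J K ∞ h) : SmoothAlong I K ι (fun x => h (f x)) := by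
  intro x
  obtain ⟨U, g, hU, hx, hg, e⟩ := hf x
  exact ⟨U, h ∘ g, hU, hx, hh.comp_contMDiffOn hg, fun y hy => congrArg h (e y hy)⟩

theorem comp {ι : X → N} {κ : Y → P} {f : Y → Q} (hf : SmoothAlong J K κ f) {u : X → Y}
    (hu : SmoothAlong I J ι (fun x => κ (u x))) : SmoothAlong I K ι (fun x => f (u x)) := by
  intro x
  obtain ⟨U, g, hU, hx, hg, e⟩ := hu x
  obtain ⟨U', g', hU', hx', hg', e'⟩ := hf (u x)
  refine ⟨U ∩ g ⁻¹' U', g' ∘ g, hg.continuousOn.isOpen_inter_preimage hU hU',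
    ⟨hx, ?_⟩, hg'.comp (hg.mono Set.inter_subset_left) (fun _ h => h.2), ?_⟩
  · rw [Set.mem_preimage, e x hx]; exact hx'
  · rintro y ⟨hy, hy'⟩
    rw [Set.mem_preimage, e y hy] at hy'
    simp only [Function.comp_apply]
    rw [e y hy, e' _ hy']

theorem prodMk {ι : X → N} {f : X → P} {g : X → Q} (hf : SmoothAlong I J ι f)
    (hg : SmoothAlong I K ι g) : SmoothAlong I (J.prod K) ι (fun x => (f x, g x)) := by
  intro x
  obtain ⟨U, k, hU, hx, hk, e⟩ := hf x
  obtain ⟨U', k', hU', hx', hk', e'⟩ := hg x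
  exact ⟨U ∩ U', fun n => (k n, k' n), hU.inter hU', ⟨hx, hx'⟩,
    (hk.mono Set.inter_subset_left).prodMk (hk'.mono Set.inter_subset_right),
    fun y hy => Prod.ext (e y hy.1) (e' y hy.2)⟩

end SmoothAlong

end SmoothAlong

/-! ### Lie groupoids -/

/-- Pairs of composable arrows `src ⟶ mid ⟶ tgt` of a category. -/
structure ComposablePair (M : Type*) [Category M] where
  {src : M}
  {mid : M}
  {tgt : M}
  fst : src ⟶ mid
  snd : mid ⟶ tgt

/-- The inclusion of the space of composable pairs of arrows into the space of all pairs of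
arrows. -/
def ComposablePair.incl {M : Type*} [Category M] (p : ComposablePair M) :
    Quiver.Total M × Quiver.Total M :=
  (⟨p.src, p.mid, p.fst⟩, ⟨p.mid, p.tgt, p.snd⟩)

/-- A Lie groupoid `G ⇉ M`: a groupoid with set of objects `M` and set of arrows
`G = Quiver.Total M`, with manifold structures on `M` and `G` for which source and target are
(surjective) submersions and unit, multiplication and inversion are smooth. The manifold of
composable pairs is the fibre product `G ×_M G ⊆ G × G`. -/
class IsLieGroupoid (EM EG M : Type*) [NormedAddCommGroup EM] [NormedSpace ℝ EM]
    [NormedAddCommGroup EG] [NormedSpace ℝ EG]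
    [Groupoid M] [TopologicalSpace M] [ChartedSpace EM M]
    [TopologicalSpace (Quiver.Total M)] [ChartedSpace EG (Quiver.Total M)] : Prop where
  isManifold_objects : IsManifold 𝓘(ℝ, EM) ∞ M
  isManifold_arrows : IsManifold 𝓘(ℝ, EG) ∞ (Quiver.Total M)
  submersion_source : IsSubmersion 𝓘(ℝ, EG) 𝓘(ℝ, EM) ∞
    (fun g : Quiver.Total M => g.left)
  submersion_target : IsSubmersion 𝓘(ℝ, EG) 𝓘(ℝ, EM) ∞
    (fun g : Quiver.Total M => g.right)
  smooth_unit : ContMDiff 𝓘(ℝ, EM) 𝓘(ℝ, EG) ∞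
    (fun x : M => (⟨x, x, 𝟙 x⟩ : Quiver.Total M))
  smooth_mul : SmoothAlong (𝓘(ℝ, EG).prod 𝓘(ℝ, EG)) 𝓘(ℝ, EG) ComposablePair.incl
    (fun p : ComposablePair M => (⟨p.src, p.tgt, p.fst ≫ p.snd⟩ : Quiver.Total M))
  smooth_inv : ContMDiff 𝓘(ℝ, EG) 𝓘(ℝ, EG) ∞
    (fun g : Quiver.Total M => (⟨g.right, g.left, Groupoid.inv g.hom⟩ : Quiver.Total M))

/-! ### Hom bundles over `M × M` -/

namespace TwoTerm

section HomBundle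

variable {EM M : Type*} [NormedAddCommGroup EM] [NormedSpace ℝ EM]
  [TopologicalSpace M] [ChartedSpace EM M]

instance pullbackAddCommGroup (A : M → Type*) [∀ x, AddCommGroup (A x)] (f : C(M × M, M))
    (p : M × M) : AddCommGroup ((f *ᵖ A) p) :=
  inferInstanceAs (AddCommGroup (A (f p)))

instance pullbackIsTopologicalAddGroup (A : M → Type*) [∀ x, AddCommGroup (A x)]
    [∀ x, TopologicalSpace (A x)] [∀ x, IsTopologicalAddGroup (A x)] (f : C(M × M, M))
    (p : M × M) : IsTopologicalAddGroup ((f *ᵖ A) p) :=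
  inferInstanceAs (IsTopologicalAddGroup (A (f p)))

instance pullbackContinuousSMul (A : M → Type*) [∀ x, AddCommGroup (A x)] [∀ x, Module ℝ (A x)]
    [∀ x, TopologicalSpace (A x)] [∀ x, ContinuousSMul ℝ (A x)] (f : C(M × M, M))
    (p : M × M) : ContinuousSMul ℝ ((f *ᵖ A) p) :=
  inferInstanceAs (ContinuousSMul ℝ (A (f p)))

/-- The vector bundle `[π₁* A, π₂* B]` over `M × M`, whose fibre over `(x, y)` is the space of
linear maps `Aˣ → Bʸ`. -/
abbrev HomBundle (A B : M → Type*)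
    [∀ x, AddCommGroup (A x)] [∀ x, Module ℝ (A x)] [∀ x, TopologicalSpace (A x)]
    [∀ x, AddCommGroup (B x)] [∀ x, Module ℝ (B x)] [∀ x, TopologicalSpace (B x)] :
    M × M → Type _ :=
  fun p => ((ContinuousMap.fst : C(M × M, M)) *ᵖ A) p →L[ℝ]
    ((ContinuousMap.snd : C(M × M, M)) *ᵖ B) p

/-- The total space of `[π₁* A, π₂* B]`. -/
abbrev HomTotal (FA FB : Type*) [NormedAddCommGroup FA] [NormedSpace ℝ FA]
    [NormedAddCommGroup FB] [NormedSpace ℝ FB] (A B : M → Type*)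
    [∀ x, AddCommGroup (A x)] [∀ x, Module ℝ (A x)] [∀ x, TopologicalSpace (A x)]
    [∀ x, AddCommGroup (B x)] [∀ x, Module ℝ (B x)] [∀ x, TopologicalSpace (B x)] :=
  TotalSpace (FA →L[ℝ] FB) (HomBundle A B)

variable
  {FA : Type*} [NormedAddCommGroup FA] [NormedSpace ℝ FA]
  {A : M → Type*} [∀ x, AddCommGroup (A x)] [∀ x, Module ℝ (A x)] [∀ x, TopologicalSpace (A x)]
  [TopologicalSpace (TotalSpace FA A)] [FiberBundle FA A] [VectorBundle ℝ FA A]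
  [∀ x, IsTopologicalAddGroup (A x)] [∀ x, ContinuousSMul ℝ (A x)]
  {FB : Type*} [NormedAddCommGroup FB] [NormedSpace ℝ FB]
  {B : M → Type*} [∀ x, AddCommGroup (B x)] [∀ x, Module ℝ (B x)] [∀ x, TopologicalSpace (B x)]
  [TopologicalSpace (TotalSpace FB B)] [FiberBundle FB B] [VectorBundle ℝ FB B]
  [∀ x, IsTopologicalAddGroup (B x)] [∀ x, ContinuousSMul ℝ (B x)]
  {FC : Type*} [NormedAddCommGroup FC] [NormedSpace ℝ FC]
  {C : M → Type*} [∀ x, AddCommGroup (C x)] [∀ x, Module ℝ (C x)] [∀ x, TopologicalSpace (C x)]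
  [TopologicalSpace (TotalSpace FC C)] [FiberBundle FC C] [VectorBundle ℝ FC C]
  [∀ x, IsTopologicalAddGroup (C x)] [∀ x, ContinuousSMul ℝ (C x)]
  {EX X : Type*} [NormedAddCommGroup EX] [NormedSpace ℝ EX] [TopologicalSpace X]
  [ChartedSpace EX X]

/-- The point of the total space of `[π₁* A, π₂* B]` given by a linear map between fibres. -/
def homMk (FA FB : Type*) [NormedAddCommGroup FA] [NormedSpace ℝ FA]
    [NormedAddCommGroup FB] [NormedSpace ℝ FB] {x y : M} (T : A x →L[ℝ] B y) :
    HomTotal FA FB A B :=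
  ⟨(x, y), T⟩

theorem pullback_symmₗ (t : Trivialization FA (π FA A)) [t.IsLinear ℝ] (f : C(M × M, M))
    (p : M × M) (v : FA) :
    (t.pullback f).symmₗ ℝ p v = t.symmₗ ℝ (f p) v := by
  by_cases hp : f p ∈ t.baseSet
  · rw [t.symmₗ_apply hp, (t.pullback f).symmₗ_apply (b := p) hp]
    have h1 : (t.pullback f) ⟨p, (t.pullback f).symm p v⟩ = (p, v) :=
      (t.pullback f).apply_mk_symm (b := p) hp v
    have h2 : (t (⟨f p, (t.pullback f).symm p v⟩ : TotalSpace FA A)).2 = v :=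
      congrArg Prod.snd h1
    have h3 := t.symm_apply_apply_mk hp ((t.pullback f).symm p v)
    rw [h2] at h3
    exact h3.symm
  · rw [t.symmₗ_apply_of_notMem hp, (t.pullback f).symmₗ_apply_of_notMem (b := p) hp]
    rfl

theorem inCoordinates_pullback (p₀ p : M × M) (T : A p.1 →L[ℝ] B p.2) :
    ContinuousLinearMap.inCoordinates FA ((ContinuousMap.fst : C(M × M, M)) *ᵖ A) FB
      ((ContinuousMap.snd : C(M × M, M)) *ᵖ B) p₀ p p₀ p T =
    ContinuousLinearMap.inCoordinates FA A FB B p₀.1 p.1 p₀.2 p.2 T := by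
  ext v
  have h1 : ((trivializationAt FA A p₀.1).pullback
      (ContinuousMap.fst : C(M × M, M))).symmₗ ℝ p v =
      (trivializationAt FA A p₀.1).symmₗ ℝ p.1 v := pullback_symmₗ _ _ _ _
  change (((trivializationAt FB B p₀.2).pullback
      (ContinuousMap.snd : C(M × M, M))).linearMapAt ℝ p)
    (T (((trivializationAt FA A p₀.1).pullback
      (ContinuousMap.fst : C(M × M, M))).symmₗ ℝ p v)) =
    ((trivializationAt FB B p₀.2).linearMapAt ℝ p.2)
      (T ((trivializationAt FA A p₀.1).symmₗ ℝ p.1 v))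
  rw [h1, Trivialization.coe_linearMapAt, Trivialization.coe_linearMapAt]
  rfl

theorem contMDiffAt_homMk_iff {a b : X → M} {T : ∀ i, A (a i) →L[ℝ] B (b i)} {i₀ : X} :
    ContMDiffAt 𝓘(ℝ, EX) ((𝓘(ℝ, EM).prod 𝓘(ℝ, EM)).prod 𝓘(ℝ, FA →L[ℝ] FB)) ∞
      (fun i => homMk FA FB (T i)) i₀ ↔
    ContMDiffAt 𝓘(ℝ, EX) 𝓘(ℝ, EM) ∞ a i₀ ∧ ContMDiffAt 𝓘(ℝ, EX) 𝓘(ℝ, EM) ∞ b i₀ ∧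
    ContMDiffAt 𝓘(ℝ, EX) 𝓘(ℝ, FA →L[ℝ] FB) ∞ (fun i =>
      ContinuousLinearMap.inCoordinates FA A FB B (a i₀) (a i) (b i₀) (b i) (T i)) i₀ := by
  have key := contMDiffAt_hom_bundle (𝕜 := ℝ) (n := ∞) (IM := 𝓘(ℝ, EX))
    (IB := 𝓘(ℝ, EM).prod 𝓘(ℝ, EM)) (F₁ := FA) (F₂ := FB)
    (E₁ := ((ContinuousMap.fst : C(M × M, M)) *ᵖ A))
    (E₂ := ((ContinuousMap.snd : C(M × M, M)) *ᵖ B))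
    (fun i => (homMk FA FB (T i) : HomTotal FA FB A B)) (x₀ := i₀)
  have hc : (fun i => ContinuousLinearMap.inCoordinates FA
      ((ContinuousMap.fst : C(M × M, M)) *ᵖ A) FB ((ContinuousMap.snd : C(M × M, M)) *ᵖ B)
      (a i₀, b i₀) (a i, b i) (a i₀, b i₀) (a i, b i) (T i)) = (fun i =>
      ContinuousLinearMap.inCoordinates FA A FB B (a i₀) (a i) (b i₀) (b i) (T i)) := by
    funext i
    exact inCoordinates_pullback (a i₀, b i₀) (a i, b i) (T i)
  refine key.trans ⟨fun h => ⟨h.1.fst, h.1.snd, ?_⟩, fun h => ⟨h.1.prodMk h.2.1, ?_⟩⟩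
  · rw [← hc]; exact h.2
  · have := h.2.2
    rw [← hc] at this
    exact this

theorem contMDiff_homMk_comp
    {a b c : X → M} {S : ∀ i, A (a i) →L[ℝ] B (b i)} {T : ∀ i, B (b i) →L[ℝ] C (c i)}
    (hS : ContMDiff 𝓘(ℝ, EX) ((𝓘(ℝ, EM).prod 𝓘(ℝ, EM)).prod 𝓘(ℝ, FA →L[ℝ] FB)) ∞
      (fun i => homMk FA FB (S i)))
    (hT : ContMDiff 𝓘(ℝ, EX) ((𝓘(ℝ, EM).prod 𝓘(ℝ, EM)).prod 𝓘(ℝ, FB →L[ℝ] FC)) ∞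
      (fun i => homMk FB FC (T i))) :
    ContMDiff 𝓘(ℝ, EX) ((𝓘(ℝ, EM).prod 𝓘(ℝ, EM)).prod 𝓘(ℝ, FA →L[ℝ] FC)) ∞
      (fun i => homMk FA FC ((T i).comp (S i))) := by
  intro i₀
  obtain ⟨ha, hb, hS'⟩ := contMDiffAt_homMk_iff.1 (hS i₀)
  obtain ⟨-, hc, hT'⟩ := contMDiffAt_homMk_iff.1 (hT i₀)
  refine contMDiffAt_homMk_iff.2 ⟨ha, hc, (hT'.clm_comp hS').congr_of_eventuallyEq ?_⟩
  have hmem : ∀ᶠ i in 𝓝 i₀, b i ∈ (trivializationAt FB B (b i₀)).baseSet :=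
    hb.continuousAt.eventually ((trivializationAt FB B (b i₀)).open_baseSet.mem_nhds
      (FiberBundle.mem_baseSet_trivializationAt' (b i₀)))
  filter_upwards [hmem] with i hi
  ext v
  simp only [ContinuousLinearMap.inCoordinates, ContinuousLinearMap.comp_apply]
  rw [Trivialization.symmL_continuousLinearMapAt _ hi]

theorem contMDiff_homMk_add
    {a b : X → M} {S T : ∀ i, A (a i) →L[ℝ] B (b i)}
    (hS : ContMDiff 𝓘(ℝ, EX) ((𝓘(ℝ, EM).prod 𝓘(ℝ, EM)).prod 𝓘(ℝ, FA →L[ℝ] FB)) ∞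
      (fun i => homMk FA FB (S i)))
    (hT : ContMDiff 𝓘(ℝ, EX) ((𝓘(ℝ, EM).prod 𝓘(ℝ, EM)).prod 𝓘(ℝ, FA →L[ℝ] FB)) ∞
      (fun i => homMk FA FB (T i))) :
    ContMDiff 𝓘(ℝ, EX) ((𝓘(ℝ, EM).prod 𝓘(ℝ, EM)).prod 𝓘(ℝ, FA →L[ℝ] FB)) ∞
      (fun i => homMk FA FB (S i + T i)) := by
  intro i₀
  obtain ⟨ha, hb, hS'⟩ := contMDiffAt_homMk_iff.1 (hS i₀)
  obtain ⟨-, -, hT'⟩ := contMDiffAt_homMk_iff.1 (hT i₀)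
  refine contMDiffAt_homMk_iff.2 ⟨ha, hb, (hS'.add hT').congr_of_eventuallyEq ?_⟩
  filter_upwards with i
  ext v
  simp [ContinuousLinearMap.inCoordinates]

theorem contMDiff_homMk_zero {a b : X → M}
    (ha : ContMDiff 𝓘(ℝ, EX) 𝓘(ℝ, EM) ∞ a) (hb : ContMDiff 𝓘(ℝ, EX) 𝓘(ℝ, EM) ∞ b) :
    ContMDiff 𝓘(ℝ, EX) ((𝓘(ℝ, EM).prod 𝓘(ℝ, EM)).prod 𝓘(ℝ, FA →L[ℝ] FB)) ∞
      (fun i => homMk FA FB (0 : A (a i) →L[ℝ] B (b i))) := by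
  intro i₀
  refine contMDiffAt_homMk_iff.2 ⟨ha i₀, hb i₀, contMDiffAt_const (c := 0)
    |>.congr_of_eventuallyEq ?_⟩
  filter_upwards with i
  ext v
  simp [ContinuousLinearMap.inCoordinates]

theorem contMDiff_homMk_id {a : X → M}
    (ha : ContMDiff 𝓘(ℝ, EX) 𝓘(ℝ, EM) ∞ a) :
    ContMDiff 𝓘(ℝ, EX) ((𝓘(ℝ, EM).prod 𝓘(ℝ, EM)).prod 𝓘(ℝ, FA →L[ℝ] FA)) ∞
      (fun i => homMk FA FA (ContinuousLinearMap.id ℝ (A (a i)))) := by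
  intro i₀
  refine contMDiffAt_homMk_iff.2 ⟨ha i₀, ha i₀,
    contMDiffAt_const (c := ContinuousLinearMap.id ℝ FA) |>.congr_of_eventuallyEq ?_⟩
  have hmem : ∀ᶠ i in 𝓝 i₀, a i ∈ (trivializationAt FA A (a i₀)).baseSet :=
    (ha i₀).continuousAt.eventually ((trivializationAt FA A (a i₀)).open_baseSet.mem_nhds
      (FiberBundle.mem_baseSet_trivializationAt' (a i₀)))
  filter_upwards [hmem] with i hi
  ext v
  simp only [ContinuousLinearMap.inCoordinates, ContinuousLinearMap.comp_apply,
    ContinuousLinearMap.id_apply]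
  rw [Trivialization.continuousLinearMapAt_symmL _ hi]

end HomBundle

/-! ### Smooth families of linear maps between fibres, as maps on fibre products -/

section SmoothFamily

variable {EM M : Type*} [NormedAddCommGroup EM] [NormedSpace ℝ EM]
  [TopologicalSpace M] [ChartedSpace EM M]
  {EN HN N : Type*} [NormedAddCommGroup EN] [NormedSpace ℝ EN] [TopologicalSpace HN]
  [TopologicalSpace N] [ChartedSpace HN N] {I : ModelWithCorners ℝ EN HN}
  {FA : Type*} [NormedAddCommGroup FA] [NormedSpace ℝ FA]
  {A : M → Type*} [∀ x, AddCommGroup (A x)] [∀ x, Module ℝ (A x)] [∀ x, TopologicalSpace (A x)]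
  [TopologicalSpace (TotalSpace FA A)] [FiberBundle FA A] [VectorBundle ℝ FA A]
  {FB : Type*} [NormedAddCommGroup FB] [NormedSpace ℝ FB]
  {B : M → Type*} [∀ x, AddCommGroup (B x)] [∀ x, Module ℝ (B x)] [∀ x, TopologicalSpace (B x)]
  [TopologicalSpace (TotalSpace FB B)] [FiberBundle FB B] [VectorBundle ℝ FB B]

theorem SmoothAlong.add_fiber [ContMDiffVectorBundle ∞ FB B 𝓘(ℝ, EM)] {X : Type*} {ι : X → N}
    {b : X → M} {v w : ∀ i, B (b i)}
    (hv : SmoothAlong I (𝓘(ℝ, EM).prod 𝓘(ℝ, FB)) ι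
      (fun i => (⟨b i, v i⟩ : TotalSpace FB B)))
    (hw : SmoothAlong I (𝓘(ℝ, EM).prod 𝓘(ℝ, FB)) ι
      (fun i => (⟨b i, w i⟩ : TotalSpace FB B))) :
    SmoothAlong I (𝓘(ℝ, EM).prod 𝓘(ℝ, FB)) ι
      (fun i => (⟨b i, v i + w i⟩ : TotalSpace FB B)) := by
  intro x
  obtain ⟨U, g, hU, hx, hg, e⟩ := hv x
  obtain ⟨U', g', hU', hx', hg', e'⟩ := hw x
  set t := trivializationAt FB B (b x) with ht
  have hbx : b x ∈ t.baseSet := FiberBundle.mem_baseSet_trivializationAt' (b x)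
  have h1 : ContMDiffOn I (𝓘(ℝ, EM).prod 𝓘(ℝ, FB)) ∞ (fun n => t (g n))
      (U ∩ g ⁻¹' t.source) :=
    t.contMDiffOn.comp (hg.mono Set.inter_subset_left) (fun _ h => h.2)
  have h2 : ContMDiffOn I (𝓘(ℝ, EM).prod 𝓘(ℝ, FB)) ∞ (fun n => t (g' n))
      (U' ∩ g' ⁻¹' t.source) :=
    t.contMDiffOn.comp (hg'.mono Set.inter_subset_left) (fun _ h => h.2)
  have h3 : ContMDiffOn I (𝓘(ℝ, EM).prod 𝓘(ℝ, FB)) ∞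
      (fun n => ((t (g n)).1, (t (g n)).2 + (t (g' n)).2))
      ((U ∩ g ⁻¹' t.source) ∩ (U' ∩ g' ⁻¹' t.source)) :=
    (contMDiff_fst.comp_contMDiffOn (h1.mono Set.inter_subset_left)).prodMk
      ((contMDiff_snd.comp_contMDiffOn (h1.mono Set.inter_subset_left)).add
        (contMDiff_snd.comp_contMDiffOn (h2.mono Set.inter_subset_right)))
  refine ⟨(U ∩ g ⁻¹' t.source) ∩ (U' ∩ g' ⁻¹' t.source), fun n =>
    t.toOpenPartialHomeomorph.symm ((t (g n)).1, (t (g n)).2 + (t (g' n)).2),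
    (hg.continuousOn.isOpen_inter_preimage hU t.open_source).inter
      (hg'.continuousOn.isOpen_inter_preimage hU' t.open_source), ⟨⟨hx, ?_⟩, ⟨hx', ?_⟩⟩,
    t.contMDiffOn_symm.comp h3 ?_, ?_⟩
  · rw [Set.mem_preimage, e x hx, t.mem_source]; exact hbx
  · rw [Set.mem_preimage, e' x hx', t.mem_source]; exact hbx
  · rintro n ⟨⟨-, hn⟩, -⟩
    rw [Set.mem_preimage, t.mem_target]
    rw [t.coe_fst hn]
    exact t.mem_source.1 hn
  · rintro y ⟨⟨hy, hys⟩, ⟨hy', -⟩⟩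
    simp only
    rw [e y hy, e' y hy']
    rw [Set.mem_preimage, e y hy] at hys
    have hb : b y ∈ t.baseSet := t.mem_source.1 hys
    have hadd : (t (⟨b y, v y⟩ : TotalSpace FB B)).2 + (t (⟨b y, w y⟩ : TotalSpace FB B)).2 =
        (t (⟨b y, v y + w y⟩ : TotalSpace FB B)).2 := by
      exact ((t.linear ℝ hb).map_add (v y) (w y)).symm
    rw [hadd]
    have hmem : (⟨b y, v y + w y⟩ : TotalSpace FB B) ∈ t.source := t.mem_source.2 hb
    have h4 : ((t (⟨b y, v y⟩ : TotalSpace FB B)).1,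
        (t (⟨b y, v y + w y⟩ : TotalSpace FB B)).2) =
        t (⟨b y, v y + w y⟩ : TotalSpace FB B) := by
      refine Prod.ext ?_ rfl
      simp only
      rw [t.coe_fst hys, t.coe_fst hmem]
    rw [h4]
    exact t.toOpenPartialHomeomorph.left_inv hmem

/-- Let `X` be a submanifold of `N` (via `ι`) with maps `a b : X → M`, and let `T` be a family
of linear maps `T i : A^{a i} → B^{b i}`, `i ∈ X`. The family is smooth if the map
`X ×_M A → B`, `(i, v) ↦ T i v`, is smooth, where `X ×_M A ⊆ N × A`. -/
def SmoothFamily (FA FB : Type*) [NormedAddCommGroup FA] [NormedSpace ℝ FA]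
    [NormedAddCommGroup FB] [NormedSpace ℝ FB]
    [TopologicalSpace (TotalSpace FA A)] [FiberBundle FA A]
    [TopologicalSpace (TotalSpace FB B)] [FiberBundle FB B]
    (I : ModelWithCorners ℝ EN HN) {X : Type*} (ι : X → N) (a b : X → M)
    (T : ∀ i, A (a i) →L[ℝ] B (b i)) : Prop :=
  SmoothAlong (I.prod (𝓘(ℝ, EM).prod 𝓘(ℝ, FA))) (𝓘(ℝ, EM).prod 𝓘(ℝ, FB))
    (fun p : Σ i : X, A (a i) => (ι p.1, (⟨a p.1, p.2⟩ : TotalSpace FA A)))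
    (fun p => (⟨b p.1, T p.1 p.2⟩ : TotalSpace FB B))

end SmoothFamily

/-! ### Smooth pseudo-functors into `GL(V)` and smooth lax equivalences -/

/-- An arrow of a 2-category is invertible up to 2-cells. -/
def InvertibleUpToTwoCells {B : Type*} [Bicategory B] {a b : B} (f : a ⟶ b) : Prop :=
  ∃ g : b ⟶ a, Nonempty (f ≫ g ≅ 𝟙 a) ∧ Nonempty (g ≫ f ≅ 𝟙 b)

theorem InvertibleUpToTwoCells.id {B : Type*} [Bicategory B] (a : B) :
    InvertibleUpToTwoCells (𝟙 a) :=
  ⟨𝟙 a, ⟨Bicategory.leftUnitor _⟩, ⟨Bicategory.leftUnitor _⟩⟩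

theorem InvertibleUpToTwoCells.comp {B : Type*} [Bicategory B] {a b c : B} {f : a ⟶ b}
    {g : b ⟶ c} (hf : InvertibleUpToTwoCells f) (hg : InvertibleUpToTwoCells g) :
    InvertibleUpToTwoCells (f ≫ g) := by
  obtain ⟨f', ⟨e₁⟩, ⟨e₂⟩⟩ := hf
  obtain ⟨g', ⟨e₃⟩, ⟨e₄⟩⟩ := hg
  open Bicategory in
  refine ⟨g' ≫ f', ⟨?_⟩, ⟨?_⟩⟩
  · exact α_ f g (g' ≫ f') ≪≫ whiskerLeftIso f ((α_ g g' f').symm ≪≫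
      whiskerRightIso e₃ f' ≪≫ λ_ f') ≪≫ e₁
  · exact α_ g' f' (f ≫ g) ≪≫ whiskerLeftIso g' ((α_ f' f g).symm ≪≫
      whiskerRightIso e₂ g ≪≫ λ_ g) ≪≫ e₄

section Main

variable (EM EG : Type*) {M : Type*} [NormedAddCommGroup EM] [NormedSpace ℝ EM]
  [NormedAddCommGroup EG] [NormedSpace ℝ EG]
  [Groupoid M] [TopologicalSpace M] [ChartedSpace EM M]
  [TopologicalSpace (Quiver.Total M)] [ChartedSpace EG (Quiver.Total M)]
  (F₁ : Type*) [NormedAddCommGroup F₁] [NormedSpace ℝ F₁]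
  (F₀ : Type*) [NormedAddCommGroup F₀] [NormedSpace ℝ F₀]
  (V₁ : M → Type*) [∀ x, AddCommGroup (V₁ x)] [∀ x, Module ℝ (V₁ x)]
  [∀ x, TopologicalSpace (V₁ x)] [∀ x, IsTopologicalAddGroup (V₁ x)]
  [∀ x, ContinuousSMul ℝ (V₁ x)]
  [TopologicalSpace (TotalSpace F₁ V₁)] [FiberBundle F₁ V₁] [VectorBundle ℝ F₁ V₁]
  [ContMDiffVectorBundle ∞ F₁ V₁ 𝓘(ℝ, EM)]
  (V₀ : M → Type*) [∀ x, AddCommGroup (V₀ x)] [∀ x, Module ℝ (V₀ x)]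
  [∀ x, TopologicalSpace (V₀ x)] [∀ x, IsTopologicalAddGroup (V₀ x)]
  [∀ x, ContinuousSMul ℝ (V₀ x)]
  [TopologicalSpace (TotalSpace F₀ V₀)] [FiberBundle F₀ V₀] [VectorBundle ℝ F₀ V₀]
  [ContMDiffVectorBundle ∞ F₀ V₀ 𝓘(ℝ, EM)]

variable {V₁ V₀}

/-- `GL(V)₀` is the total space of the vector bundle `[V₁, V₀] → M`. -/
def objTotal (a : GLObj V₁ V₀) :
    TotalSpace (F₁ →L[ℝ] F₀) (fun x : M => V₁ x →L[ℝ] V₀ x) :=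
  ⟨a.base, a.d⟩

/-- The embedding of `GL(V)₁` which sends `α : dˣ → dʸ` to `(dˣ, dʸ, α₁, α₀)`. Its image lies in
the Whitney sum over `M × M` of the bundles `[π₁* V₁, π₁* V₀]`, `[π₂* V₁, π₂* V₀]`,
`[π₁* V₁, π₂* V₁]` and `[π₁* V₀, π₂* V₀]`, itself a submanifold of the product below. A map into
the (embedded) submanifold `GL(V)₁` is smooth iff it is smooth as a map into this product. -/
def homEmbed {a b : GLObj V₁ V₀} (α : GLHom a b) :
    TotalSpace (F₁ →L[ℝ] F₀) (fun x : M => V₁ x →L[ℝ] V₀ x) ×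
    TotalSpace (F₁ →L[ℝ] F₀) (fun x : M => V₁ x →L[ℝ] V₀ x) ×
    HomTotal F₁ F₁ V₁ V₁ × HomTotal F₀ F₀ V₀ V₀ :=
  (objTotal F₁ F₀ a, objTotal F₁ F₀ b, homMk F₁ F₁ α.f₁, homMk F₀ F₀ α.f₀)

/-- The embedding of `GL(V)₂ = GL(V)₁ ×_{M × M} [π₁* V₀, π₂* V₁]`, which sends a 2-cell
`R : α ⇒ β` to `(α, R)`. -/
def cellEmbed {a b : GLObj V₁ V₀} {α β : GLHom a b} (S : GLCell α β) :
    (TotalSpace (F₁ →L[ℝ] F₀) (fun x : M => V₁ x →L[ℝ] V₀ x) ×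
    TotalSpace (F₁ →L[ℝ] F₀) (fun x : M => V₁ x →L[ℝ] V₀ x) ×
    HomTotal F₁ F₁ V₁ V₁ × HomTotal F₀ F₀ V₀ V₀) × HomTotal F₀ F₁ V₀ V₁ :=
  (homEmbed F₁ F₀ α, homMk F₀ F₁ S.R)

/-- The model with corners of the manifold `GL(V)₀`. -/
noncomputable abbrev objModel := 𝓘(ℝ, EM).prod 𝓘(ℝ, F₁ →L[ℝ] F₀)

/-- The model with corners of the total space of `[π₁* A, π₂* B]`. -/
noncomputable abbrev homTotalModel (FA FB : Type*) [NormedAddCommGroup FA] [NormedSpace ℝ FA]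
    [NormedAddCommGroup FB] [NormedSpace ℝ FB] :=
  (𝓘(ℝ, EM).prod 𝓘(ℝ, EM)).prod 𝓘(ℝ, FA →L[ℝ] FB)

/-- The model with corners of the manifold in which `GL(V)₁` is embedded. -/
noncomputable abbrev homModel := (objModel EM F₁ F₀).prod ((objModel EM F₁ F₀).prod
  ((homTotalModel EM F₁ F₁).prod (homTotalModel EM F₀ F₀)))

/-- The model with corners of the manifold in which `GL(V)₂` is embedded. -/
noncomputable abbrev cellModel := (homModel EM F₁ F₀).prod (homTotalModel EM F₀ F₁)

variable (V₁ V₀)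

/-- Smooth pseudo-functors `φ : G ⇢ GL(V)` with `π_V φ = π_G`, where the Lie groupoid `G` is seen
as a 2-category with only identity 2-cells. These are normal (strictly unitary) pseudo-functors
whose structure 2-cells `φ(h g) ⇒ φ(h) φ(g)` are `(mapComp g h).hom`. -/
structure SmoothPseudofunctor extends
    StrictlyUnitaryPseudofunctor (LocallyDiscrete M) (GLObj V₁ V₀) where
  /-- `π_V φ = π_G`; since `Pair(M)` has exactly one arrow between any two objects and only
  identity 2-cells, this is a condition on objects. -/
  base_obj (x : M) : (obj ⟨x⟩).base = x
  /-- smoothness of `φ₀ : M → GL(V)₀` -/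
  smooth_obj : ContMDiff 𝓘(ℝ, EM) (objModel EM F₁ F₀) ∞
    (fun x : M => objTotal F₁ F₀ (obj ⟨x⟩))
  /-- smoothness of `φ₁ : G → GL(V)₁` -/
  smooth_map : ContMDiff 𝓘(ℝ, EG) (homModel EM F₁ F₀) ∞
    (fun g : Quiver.Total M => homEmbed F₁ F₀ (map g.hom.toLoc))
  /-- smoothness of the map `N₂ G = G ×_M G → N₂ GL(V)`, where `N₂ GL(V)` is the space of triples
  consisting of two composable arrows and a 2-cell with target their composite -/
  smooth_mapComp : SmoothAlong (𝓘(ℝ, EG).prod 𝓘(ℝ, EG))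
    ((homModel EM F₁ F₀).prod ((homModel EM F₁ F₀).prod (cellModel EM F₁ F₀)))
    ComposablePair.incl
    (fun p : ComposablePair M =>
      (homEmbed F₁ F₀ (map p.fst.toLoc), homEmbed F₁ F₀ (map p.snd.toLoc),
        cellEmbed F₁ F₀ (mapComp p.fst.toLoc p.snd.toLoc).hom))

variable {EM EG F₁ F₀ V₁ V₀}

/-- Smooth lax equivalences `H : φ ⇒ ψ`: lax transformations, with components
`H_x : φ(x) → ψ(x)` and `H_g : H_y φ(g) ⇒ ψ(g) H_x` for `g : x → y`, such that the `H_g` are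
invertible, the `H_x` are invertible up to 2-cells, and `M → GL(V)₁`, `G → GL(V)₂` are smooth. -/
structure SmoothLaxEquivalence (φ ψ : SmoothPseudofunctor EM EG F₁ F₀ V₁ V₀) where
  /-- the lax transformation with invertible 2-cells -/
  trans : Pseudofunctor.StrongTrans φ.toPseudofunctor ψ.toPseudofunctor
  invertible_app (x : M) : InvertibleUpToTwoCells (trans.app ⟨x⟩)
  smooth_app : ContMDiff 𝓘(ℝ, EM) (homModel EM F₁ F₀) ∞
    (fun x : M => homEmbed F₁ F₀ (trans.app ⟨x⟩))
  smooth_naturality : ContMDiff 𝓘(ℝ, EG) (cellModel EM F₁ F₀) ∞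
    (fun g : Quiver.Total M => cellEmbed F₁ F₀ (trans.naturality g.hom.toLoc).hom)

theorem strongTrans_ext {B : Type*} [Bicategory B] {F G : Pseudofunctor B (GLObj V₁ V₀)}
    {η θ : Pseudofunctor.StrongTrans F G} (happ : ∀ a, η.app a = θ.app a)
    (hnat : ∀ {a b : B} (f : a ⟶ b),
      GLCell.R (η.naturality f).hom = GLCell.R (θ.naturality f).hom) : η = θ := by
  obtain ⟨app, nat, _, _, _⟩ := η
  obtain ⟨app', nat', _, _, _⟩ := θ
  obtain rfl : app = app' := funext happ
  obtain rfl : @nat = @nat' := by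
    funext a b f
    exact Iso.ext (GLCell.ext_R (hnat f))
  rfl

namespace SmoothLaxEquivalence

theorem ext' {φ ψ : SmoothPseudofunctor EM EG F₁ F₀ V₁ V₀} {H K : SmoothLaxEquivalence φ ψ}
    (h : H.trans = K.trans) : H = K := by
  cases H; cases K; cases h; rfl

/-- The 2-cells of the composite of two lax transformations. -/
theorem vcomp_naturality_R {B : Type*} [Bicategory B] {F G H : Pseudofunctor B (GLObj V₁ V₀)}
    (η : Pseudofunctor.StrongTrans F G) (θ : Pseudofunctor.StrongTrans G H) {a b : B}
    (f : a ⟶ b) :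
    GLCell.R ((η.vcomp θ).naturality f).hom =
      (GLHom.f₁ (θ.app b)).comp (GLCell.R (η.naturality f).hom) +
        (GLCell.R (θ.naturality f).hom).comp (GLHom.f₀ (η.app a)) := by
  change 0 + ((GLHom.f₁ (θ.app b)).comp (GLCell.R (η.naturality f).hom) + (0 +
    ((GLCell.R (θ.naturality f).hom).comp (GLHom.f₀ (η.app a)) + 0))) = _
  simp

theorem id_naturality_R {B : Type*} [Bicategory B] {F : Pseudofunctor B (GLObj V₁ V₀)} {a b : B}
    (f : a ⟶ b) :
    GLCell.R ((Pseudofunctor.StrongTrans.id F).naturality f).hom = 0 :=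
  add_zero 0

variable [IsLieGroupoid EM EG M]

/-- The identity transformation. -/
def id (φ : SmoothPseudofunctor EM EG F₁ F₀ V₁ V₀) : SmoothLaxEquivalence φ φ where
  trans := Pseudofunctor.StrongTrans.id _
  invertible_app _ := InvertibleUpToTwoCells.id _
  smooth_app := by
    have hb : ContMDiff 𝓘(ℝ, EM) 𝓘(ℝ, EM) ∞ (fun x : M => (φ.obj ⟨x⟩).base) := by
      simp only [φ.base_obj]; exact contMDiff_id
    exact φ.smooth_obj.prodMk (φ.smooth_obj.prodMk
      ((contMDiff_homMk_id hb).prodMk (contMDiff_homMk_id hb)))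
  smooth_naturality := by
    have hs : ContMDiff 𝓘(ℝ, EG) 𝓘(ℝ, EM) ∞
        (fun g : Quiver.Total M => (φ.obj ⟨g.left⟩).base) := by
      simp only [φ.base_obj]; exact (IsLieGroupoid.submersion_source (EM := EM) (EG := EG) (M := M)).contMDiff
    have ht : ContMDiff 𝓘(ℝ, EG) 𝓘(ℝ, EM) ∞
        (fun g : Quiver.Total M => (φ.obj ⟨g.right⟩).base) := by
      simp only [φ.base_obj]; exact (IsLieGroupoid.submersion_target (EM := EM) (EG := EG) (M := M)).contMDiff
    refine ContMDiff.prodMk φ.smooth_map ?_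
    simp only [id_naturality_R]
    exact contMDiff_homMk_zero hs ht

/-- The composite of two transformations. -/
def comp {φ ψ χ : SmoothPseudofunctor EM EG F₁ F₀ V₁ V₀} (H : SmoothLaxEquivalence φ ψ)
    (K : SmoothLaxEquivalence ψ χ) : SmoothLaxEquivalence φ χ where
  trans := H.trans.vcomp K.trans
  invertible_app x := (H.invertible_app x).comp (K.invertible_app x)
  smooth_app := by
    have h := H.smooth_app
    have k := K.smooth_app
    exact h.fst.prodMk (k.snd.fst.prodMk
      ((contMDiff_homMk_comp h.snd.snd.fst k.snd.snd.fst).prodMk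
        (contMDiff_homMk_comp h.snd.snd.snd k.snd.snd.snd)))
  smooth_naturality := by
    have h := H.smooth_naturality
    have k := K.smooth_naturality
    have hx := H.smooth_app.comp
      (IsLieGroupoid.submersion_source (EM := EM) (EG := EG) (M := M)).contMDiff
    have kx := K.smooth_app.comp
      (IsLieGroupoid.submersion_target (EM := EM) (EG := EG) (M := M)).contMDiff
    have e₁ := contMDiff_homMk_comp h.fst.snd.snd.fst kx.snd.snd.fst
    have e₀ := contMDiff_homMk_comp h.fst.snd.snd.snd kx.snd.snd.snd
    have e := h.fst.fst.prodMk (kx.snd.fst.prodMk (e₁.prodMk e₀))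
    refine ContMDiff.prodMk e ?_
    simp only [vcomp_naturality_R]
    exact contMDiff_homMk_add (contMDiff_homMk_comp h.snd kx.snd.snd.fst)
      (contMDiff_homMk_comp hx.snd.snd.snd k.snd)

end SmoothLaxEquivalence

/-- The category of smooth pseudo-functors `G ⇢ GL(V)` over `Pair(M)` and smooth lax
equivalences. -/
instance SmoothPseudofunctor.category [IsLieGroupoid EM EG M] :
    Category (SmoothPseudofunctor EM EG F₁ F₀ V₁ V₀) where
  Hom φ ψ := SmoothLaxEquivalence φ ψ
  id φ := SmoothLaxEquivalence.id φ
  comp H K := H.comp K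
  id_comp H := SmoothLaxEquivalence.ext' (strongTrans_ext (fun _ => rfl) (fun f =>
    (SmoothLaxEquivalence.vcomp_naturality_R (Pseudofunctor.StrongTrans.id _) H.trans f).trans (by
      rw [SmoothLaxEquivalence.id_naturality_R, ContinuousLinearMap.comp_zero, zero_add]
      exact ContinuousLinearMap.comp_id _)))
  comp_id H := SmoothLaxEquivalence.ext' (strongTrans_ext (fun _ => rfl) (fun f =>
    (SmoothLaxEquivalence.vcomp_naturality_R H.trans (Pseudofunctor.StrongTrans.id _) f).trans (by
      rw [SmoothLaxEquivalence.id_naturality_R, ContinuousLinearMap.zero_comp, add_zero]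
      exact ContinuousLinearMap.id_comp _)))
  assoc H K L := SmoothLaxEquivalence.ext' (strongTrans_ext (fun _ => rfl) (fun f => by
    refine (SmoothLaxEquivalence.vcomp_naturality_R (H.trans.vcomp K.trans) L.trans f).trans
      (Eq.trans ?_ (SmoothLaxEquivalence.vcomp_naturality_R H.trans
        (K.trans.vcomp L.trans) f).symm)
    rw [SmoothLaxEquivalence.vcomp_naturality_R, SmoothLaxEquivalence.vcomp_naturality_R]
    rw [ContinuousLinearMap.comp_add, ContinuousLinearMap.add_comp, add_assoc]
    rfl))

/-! ### 2-term representations up to homotopy -/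

variable (EM EG F₁ F₀ V₁ V₀)

/-- A representation up to homotopy of the Lie groupoid `G ⇉ M` on the graded vector bundle
`V = V₁ ⊕ V₀`. For `g : x ⟶ y` and `h : y ⟶ z`, the map `γ g h` is the one usually written
`γ^{h,g} : V₀ˣ → V₁ᶻ`. -/
structure RepUpToHomotopy where
  /-- the differential `∂ : V₁ → V₀` -/
  d (x : M) : V₁ x →L[ℝ] V₀ x
  /-- the pseudo-representation on `V₁` -/
  ρ₁ {x y : M} (g : x ⟶ y) : V₁ x →L[ℝ] V₁ y
  /-- the pseudo-representation on `V₀` -/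
  ρ₀ {x y : M} (g : x ⟶ y) : V₀ x →L[ℝ] V₀ y
  /-- the curvature tensor -/
  γ {x y z : M} (g : x ⟶ y) (h : y ⟶ z) : V₀ x →L[ℝ] V₁ z
  ρ₁_id (x : M) : ρ₁ (𝟙 x) = ContinuousLinearMap.id ℝ (V₁ x)
  ρ₀_id (x : M) : ρ₀ (𝟙 x) = ContinuousLinearMap.id ℝ (V₀ x)
  /-- the pseudo-representations commute with `∂` -/
  ρ_d {x y : M} (g : x ⟶ y) (v : V₁ x) : ρ₀ g (d x v) = d y (ρ₁ g v)
  /-- `γ^{h,g}` is a chain homotopy `ρ^{hg} ⇒ ρ^h ρ^g` -/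
  γ_d {x y z : M} (g : x ⟶ y) (h : y ⟶ z) (v : V₁ x) :
    γ g h (d x v) = ρ₁ (g ≫ h) v - ρ₁ h (ρ₁ g v)
  d_γ {x y z : M} (g : x ⟶ y) (h : y ⟶ z) (w : V₀ x) :
    d z (γ g h w) = ρ₀ (g ≫ h) w - ρ₀ h (ρ₀ g w)
  /-- the cocycle equation of `γ` -/
  cocycle {x y z t : M} (g₁ : x ⟶ y) (g₂ : y ⟶ z) (g₃ : z ⟶ t) (w : V₀ x) :
    ρ₁ g₃ (γ g₁ g₂ w) - γ g₁ (g₂ ≫ g₃) w + γ (g₁ ≫ g₂) g₃ w - γ g₂ g₃ (ρ₀ g₁ w) = 0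
  /-- `∂ : V₁ → V₀` is smooth -/
  smooth_d : ContMDiff (𝓘(ℝ, EM).prod 𝓘(ℝ, F₁)) (𝓘(ℝ, EM).prod 𝓘(ℝ, F₀)) ∞
    (fun v : TotalSpace F₁ V₁ => (⟨v.1, d v.1 v.2⟩ : TotalSpace F₀ V₀))
  /-- `G ×_M V₁ → V₁` is smooth -/
  smooth_ρ₁ : SmoothFamily (EM := EM) F₁ F₁ 𝓘(ℝ, EG) (fun g : Quiver.Total M => g)
    (fun g => g.left) (fun g => g.right) (fun g => ρ₁ g.hom)
  /-- `G ×_M V₀ → V₀` is smooth -/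
  smooth_ρ₀ : SmoothFamily (EM := EM) F₀ F₀ 𝓘(ℝ, EG) (fun g : Quiver.Total M => g)
    (fun g => g.left) (fun g => g.right) (fun g => ρ₀ g.hom)
  /-- `(G ×_M G) ×_M V₀ → V₁` is smooth -/
  smooth_γ : SmoothFamily (EM := EM) F₀ F₁ (𝓘(ℝ, EG).prod 𝓘(ℝ, EG)) ComposablePair.incl
    (fun p : ComposablePair M => p.src) (fun p => p.tgt) (fun p => γ p.fst p.snd)

variable {EM EG F₁ F₀ V₁ V₀}

/-- Quasi-isomorphisms `(θ₁, θ₀, μ) : (V, ∂, ρ, γ) → (V, ∂', ρ', γ')` between representations up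
to homotopy of `G` on `V`. -/
structure RuthQuasiIso (E E' : RepUpToHomotopy EM EG F₁ F₀ V₁ V₀) where
  θ₁ (x : M) : V₁ x →L[ℝ] V₁ x
  θ₀ (x : M) : V₀ x →L[ℝ] V₀ x
  μ {x y : M} (g : x ⟶ y) : V₀ x →L[ℝ] V₁ y
  /-- `θ` is a chain map -/
  comm (x : M) (v : V₁ x) : θ₀ x (E.d x v) = E'.d x (θ₁ x v)
  /-- `θ` induces isomorphisms on the point-wise homology -/
  quasiIso (x : M) : IsQuasiIso (E.d x) (E'.d x) (θ₁ x) (θ₀ x) (comm x)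
  /-- `μ^g` is a chain homotopy `θ ρ^g ⇒ ρ'^g θ` -/
  μ_d {x y : M} (g : x ⟶ y) (v : V₁ x) :
    μ g (E.d x v) = θ₁ y (E.ρ₁ g v) - E'.ρ₁ g (θ₁ x v)
  d_μ {x y : M} (g : x ⟶ y) (w : V₀ x) :
    E'.d y (μ g w) = θ₀ y (E.ρ₀ g w) - E'.ρ₀ g (θ₀ x w)
  /-- compatibility of `μ` with the curvature tensors -/
  coherence {x y z : M} (g : x ⟶ y) (h : y ⟶ z) (w : V₀ x) :
    θ₁ z (E.γ g h w) + μ h (E.ρ₀ g w) + E'.ρ₁ h (μ g w) - μ (g ≫ h) w - E'.γ g h (θ₀ x w) = 0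
  smooth_θ₁ : ContMDiff (𝓘(ℝ, EM).prod 𝓘(ℝ, F₁)) (𝓘(ℝ, EM).prod 𝓘(ℝ, F₁)) ∞
    (fun v : TotalSpace F₁ V₁ => (⟨v.1, θ₁ v.1 v.2⟩ : TotalSpace F₁ V₁))
  smooth_θ₀ : ContMDiff (𝓘(ℝ, EM).prod 𝓘(ℝ, F₀)) (𝓘(ℝ, EM).prod 𝓘(ℝ, F₀)) ∞
    (fun v : TotalSpace F₀ V₀ => (⟨v.1, θ₀ v.1 v.2⟩ : TotalSpace F₀ V₀))
  /-- `G ×_M V₀ → V₁` is smooth -/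
  smooth_μ : SmoothFamily (EM := EM) F₀ F₁ 𝓘(ℝ, EG) (fun g : Quiver.Total M => g)
    (fun g => g.left) (fun g => g.right) (fun g => μ g.hom)

namespace RuthQuasiIso

theorem ext' {E E' : RepUpToHomotopy EM EG F₁ F₀ V₁ V₀} {S T : RuthQuasiIso E E'}
    (h₁ : S.θ₁ = T.θ₁) (h₀ : S.θ₀ = T.θ₀)
    (h : ∀ {x y : M} (g : x ⟶ y), S.μ g = T.μ g) : S = T := by
  obtain ⟨θ₁, θ₀, μ, _⟩ := S
  obtain ⟨θ₁', θ₀', μ', _⟩ := T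
  obtain rfl : θ₁ = θ₁' := h₁
  obtain rfl : θ₀ = θ₀' := h₀
  obtain rfl : @μ = @μ' := by
    funext x y g
    exact h g
  rfl

variable [IsLieGroupoid EM EG M]

/-- The identity morphism. -/
def id (E : RepUpToHomotopy EM EG F₁ F₀ V₁ V₀) : RuthQuasiIso E E where
  θ₁ _ := ContinuousLinearMap.id ℝ _
  θ₀ _ := ContinuousLinearMap.id ℝ _
  μ _ := 0
  comm _ _ := rfl
  quasiIso _ := IsQuasiIso.refl _
  μ_d _ _ := by simp
  d_μ _ _ := by simp
  coherence _ _ _ := by simp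
  smooth_θ₁ := contMDiff_id
  smooth_θ₀ := contMDiff_id
  smooth_μ := by
    have h : ContMDiff (𝓘(ℝ, EG).prod (𝓘(ℝ, EM).prod 𝓘(ℝ, F₀))) (𝓘(ℝ, EM).prod 𝓘(ℝ, F₁)) ∞
        (fun q : Quiver.Total M × TotalSpace F₀ V₀ => zeroSection F₁ V₁ q.1.right) :=
      (contMDiff_zeroSection ℝ V₁).comp
        ((IsLieGroupoid.submersion_target (EM := EM) (EG := EG) (M := M)).contMDiff.comp
          contMDiff_fst)
    exact SmoothAlong.of_contMDiff _ h

/-- Composition: `(θ', μ') ∘ (θ, μ) = (θ' θ, θ' μ + μ' θ)`. -/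
def comp {E E' E'' : RepUpToHomotopy EM EG F₁ F₀ V₁ V₀} (S : RuthQuasiIso E E')
    (T : RuthQuasiIso E' E'') : RuthQuasiIso E E'' where
  θ₁ x := (T.θ₁ x).comp (S.θ₁ x)
  θ₀ x := (T.θ₀ x).comp (S.θ₀ x)
  μ {x y} g := (T.θ₁ y).comp (S.μ g) + (T.μ g).comp (S.θ₀ x)
  comm x v := by simp [S.comm, T.comm]
  quasiIso x := (T.quasiIso x).comp (S.quasiIso x)
  μ_d g v := by simp [S.μ_d, S.comm, T.μ_d]
  d_μ g w := by simp [S.d_μ, ← T.comm, T.d_μ]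
  coherence {x y z} g h w := by
    have e₁ := congrArg (T.θ₁ z) (S.coherence g h w)
    have e₂ := T.coherence g h (S.θ₀ x w)
    have e₃ := T.μ_d h (S.μ g w)
    have e₄ := congrArg (T.μ h) (S.d_μ g w)
    simp only [map_add, map_sub, map_zero] at e₁ e₄
    simp only [ContinuousLinearMap.comp_apply, add_apply, map_add]
    linear_combination (norm := module) e₁ + e₂ + e₃ - e₄
  smooth_θ₁ := T.smooth_θ₁.comp S.smooth_θ₁
  smooth_θ₀ := T.smooth_θ₀.comp S.smooth_θ₀
  smooth_μ := by
    have h₁ := S.smooth_μ.postcomp T.smooth_θ₁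
    have hu : SmoothAlong (𝓘(ℝ, EG).prod (𝓘(ℝ, EM).prod 𝓘(ℝ, F₀)))
        (𝓘(ℝ, EG).prod (𝓘(ℝ, EM).prod 𝓘(ℝ, F₀)))
        (fun p : Σ g : Quiver.Total M, V₀ g.left =>
          (p.1, (⟨p.1.left, p.2⟩ : TotalSpace F₀ V₀)))
        (fun p => (p.1, (⟨p.1.left, S.θ₀ p.1.left p.2⟩ : TotalSpace F₀ V₀))) :=
      SmoothAlong.of_contMDiff _ (contMDiff_fst.prodMk (S.smooth_θ₀.comp contMDiff_snd))
    have h₂ := SmoothAlong.comp T.smooth_μ (u := fun p : Σ g : Quiver.Total M, V₀ g.left =>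
      ⟨p.1, S.θ₀ p.1.left p.2⟩) hu
    exact SmoothAlong.add_fiber h₁ h₂

end RuthQuasiIso

/-- The category of representations up to homotopy of `G` on `V` and quasi-isomorphisms. -/
instance RepUpToHomotopy.category [IsLieGroupoid EM EG M] :
    Category (RepUpToHomotopy EM EG F₁ F₀ V₁ V₀) where
  Hom E E' := RuthQuasiIso E E'
  id E := RuthQuasiIso.id E
  comp S T := S.comp T
  id_comp S := RuthQuasiIso.ext' rfl rfl (fun g => by
    change (S.θ₁ _).comp 0 + (S.μ g).comp (ContinuousLinearMap.id ℝ _) = S.μ g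
    simp)
  comp_id S := RuthQuasiIso.ext' rfl rfl (fun g => by
    change (ContinuousLinearMap.id ℝ _).comp (S.μ g) + (0 : _ →L[ℝ] _).comp (S.θ₀ _) = S.μ g
    simp)
  assoc S T U := RuthQuasiIso.ext' rfl rfl (fun {x y} g => by
    change (U.θ₁ y).comp ((T.θ₁ y).comp (S.μ g) + (T.μ g).comp (S.θ₀ x)) +
        (U.μ g).comp ((T.θ₀ x).comp (S.θ₀ x)) =
      ((U.θ₁ y).comp (T.θ₁ y)).comp (S.μ g) +
        ((U.θ₁ y).comp (T.μ g) + (U.μ g).comp (T.θ₀ x)).comp (S.θ₀ x)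
    rw [ContinuousLinearMap.comp_add, ContinuousLinearMap.add_comp, add_assoc]
    rfl)

end Main

end TwoTerm

/-!
A representation up to homotopy `(∂, ρ, γ)` and a pseudo-functor `G ⇢ GL(V)` over `Pair(M)` consist
of the same data: the complexes `∂ˣ` are the values on objects, the chain maps `ρ^g` the values on
arrows, and the homotopies `γ^{h,g} : ρ^{hg} ⇒ ρ^h ρ^g` the structure 2-cells. The cocycle equation
of `γ` is the associativity coherence. In the same way a quasi-isomorphism `(θ, μ)` is a lax
transformation with components `θˣ` and `μ^g`, and its coherence equation is the compatibility of
the transformation with composition. Four points need an argument.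

* *Units.* A strictly unitary pseudo-functor has `γ^{g,1} = 0 = γ^{1,g}`, which is not required of a
  representation. The cocycle equation expresses both through `γ^{1,1}`, and every representation
  is isomorphic to one with `γ^{1,1} = 0`: the cochain `μ^g = -γ^{g,1}`, together with the identity
  maps, is an isomorphism onto a representation with the same `∂` and `ρ` (`isoNormalize`). Hence the
  full subcategory of normalized representations is equivalent to the whole category, and it is
  compared with the category of pseudo-functors by the functor `comparison`. Between normalized
  representations `μ^1 = 0` holds automatically (`RuthQuasiIso.μ_id`).
* *Invertibility.* The arrows of `GL(V)` are quasi-isomorphisms. The chain map `ρ^g` is one because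
  `ρ^{g⁻¹}` is a homotopy inverse (`IsQuasiIso.of_homotopyInverse`). Conversely every
  quasi-isomorphism of two-term complexes of finite dimensional vector spaces has a homotopy inverse,
  obtained by splitting its mapping cone (`IsQuasiIso.exists_homotopyInverse`), so the components of
  a transformation are invertible up to 2-cells.
* *Smoothness.* On one side smoothness refers to maps `X ×_M A → B` on fibre products, on the other
  to maps from `X` to the total space of a Hom bundle. The two notions agree by looking at matrices
  in local frames (`SmoothFamily.smoothAlong_homMk`, `SmoothAlong.smoothFamily`).
* *Base points.* A pseudo-functor over `Pair(M)` has `base (φ x) = x` only as a propositional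
  equality. Essential surjectivity is a proposition, so there `φ` may be replaced by a
  pseudo-functor whose value at `x` is literally a complex over `x` (`exists_eq_of_base_eq`).
-/

/-! ### Homotopy inverses of quasi-isomorphisms -/

namespace IsQuasiIso

variable {A₁ A₀ B₁ B₀ : Type*}
    [AddCommGroup A₁] [Module ℝ A₁] [TopologicalSpace A₁]
    [AddCommGroup A₀] [Module ℝ A₀] [TopologicalSpace A₀]
    [AddCommGroup B₁] [Module ℝ B₁] [TopologicalSpace B₁]
    [AddCommGroup B₀] [Module ℝ B₀] [TopologicalSpace B₀]
    {d : A₁ →L[ℝ] A₀} {d' : B₁ →L[ℝ] B₀} {α₁ : A₁ →L[ℝ] B₁} {α₀ : A₀ →L[ℝ] B₀}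
    {comm : ∀ v, α₀ (d v) = d' (α₁ v)}

/-- A chain map with a homotopy inverse is a quasi-isomorphism. -/
theorem of_homotopyInverse (comm : ∀ v, α₀ (d v) = d' (α₁ v))
    {β₁ : B₁ →L[ℝ] A₁} {β₀ : B₀ →L[ℝ] A₀} {R : A₀ →L[ℝ] A₁} {S : B₀ →L[ℝ] B₁}
    (hβ : ∀ u, β₀ (d' u) = d (β₁ u))
    (R_d : ∀ v, R (d v) = β₁ (α₁ v) - v) (d_R : ∀ w, d (R w) = β₀ (α₀ w) - w)
    (S_d : ∀ u, S (d' u) = α₁ (β₁ u) - u) (d_S : ∀ z, d' (S z) = α₀ (β₀ z) - z) :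
    IsQuasiIso d d' α₁ α₀ comm where
  bijective_ker := by
    constructor
    · rw [injective_iff_map_eq_zero]
      rintro ⟨v, hv⟩ h
      have hv : d v = 0 := hv
      have h : α₁ v = 0 := congrArg Subtype.val h
      have h1 := R_d v
      rw [hv, h, map_zero, map_zero, zero_sub, eq_comm, neg_eq_zero] at h1
      exact Subtype.ext h1
    · rintro ⟨u, hu⟩
      have hu : d' u = 0 := hu
      refine ⟨⟨β₁ u, ?_⟩, Subtype.ext ?_⟩
      · change d (β₁ u) = 0
        rw [← hβ, hu, map_zero]
      · change α₁ (β₁ u) = u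
        have h1 := S_d u
        rw [hu, map_zero, eq_comm, sub_eq_zero] at h1
        exact h1
  bijective_coker := by
    constructor
    · rw [injective_iff_map_eq_zero]
      intro w h
      induction w using Submodule.Quotient.induction_on with
      | _ w =>
      rw [Submodule.mapQ_apply, Submodule.Quotient.mk_eq_zero] at h
      obtain ⟨u, hu⟩ := h
      have hu : d' u = α₀ w := hu
      rw [Submodule.Quotient.mk_eq_zero]
      refine ⟨β₁ u - R w, ?_⟩
      change d (β₁ u - R w) = w
      rw [map_sub, ← hβ, hu, d_R, sub_sub_cancel]
    · intro z
      induction z using Submodule.Quotient.induction_on with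
      | _ z =>
      refine ⟨Submodule.Quotient.mk (β₀ z), ?_⟩
      rw [Submodule.mapQ_apply, Submodule.Quotient.eq]
      exact ⟨S z, d_S z⟩

theorem eq_zero_of_map_eq_zero (h : IsQuasiIso d d' α₁ α₀ comm) {v : A₁} (hd : d v = 0)
    (hα : α₁ v = 0) : v = 0 :=
  congrArg Subtype.val (h.bijective_ker.1 (a₁ := ⟨v, hd⟩) (a₂ := 0) (Subtype.ext (by
    change α₁ v = α₁ 0
    rw [hα, map_zero])))

theorem exists_preimage_of_mem_ker (h : IsQuasiIso d d' α₁ α₀ comm) {u : B₁} (hu : d' u = 0) :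
    ∃ v, d v = 0 ∧ α₁ v = u := by
  obtain ⟨⟨v, hv⟩, e⟩ := h.bijective_ker.2 ⟨u, hu⟩
  exact ⟨v, hv, congrArg Subtype.val e⟩

theorem exists_boundary (h : IsQuasiIso d d' α₁ α₀ comm) {w : A₀} {u : B₁} (hw : α₀ w = d' u) :
    ∃ v, d v = w := by
  have h1 : (Submodule.Quotient.mk w : A₀ ⧸ LinearMap.range (d : A₁ →ₗ[ℝ] A₀)) = 0 := by
    apply h.bijective_coker.1
    rw [map_zero, Submodule.mapQ_apply, Submodule.Quotient.mk_eq_zero]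
    exact ⟨u, hw.symm⟩
  exact (Submodule.Quotient.mk_eq_zero _).1 h1

theorem exists_preimage_add_boundary (h : IsQuasiIso d d' α₁ α₀ comm) (z : B₀) :
    ∃ w u, α₀ w - d' u = z := by
  obtain ⟨w, hw⟩ := h.bijective_coker.2 (Submodule.Quotient.mk z)
  induction w using Submodule.Quotient.induction_on with
  | _ w =>
  rw [Submodule.mapQ_apply, Submodule.Quotient.eq] at hw
  obtain ⟨u, hu⟩ := hw
  have hu : d' u = α₀ w - z := hu
  exact ⟨w, u, by rw [hu, sub_sub_cancel]⟩

/-- A quasi-isomorphism between two-term complexes of vector spaces has a homotopy inverse.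
For a quasi-isomorphism `α` the mapping cone `A₁ → A₀ × B₁ → B₀`, with maps `v ↦ (d v, α₁ v)` and
`(w, u) ↦ α₀ w - d' u`, is a short exact sequence; the four components of a splitting are the
homotopy inverse and, up to sign, the two homotopies. -/
theorem exists_homotopyInverse
    [IsTopologicalAddGroup A₁] [ContinuousSMul ℝ A₁]
    [IsTopologicalAddGroup A₀] [ContinuousSMul ℝ A₀] [T2Space A₀] [FiniteDimensional ℝ A₀]
    [IsTopologicalAddGroup B₁] [ContinuousSMul ℝ B₁] [T2Space B₁] [FiniteDimensional ℝ B₁]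
    [IsTopologicalAddGroup B₀] [ContinuousSMul ℝ B₀] [T2Space B₀] [FiniteDimensional ℝ B₀]
    (h : IsQuasiIso d d' α₁ α₀ comm) :
    ∃ (β₁ : B₁ →L[ℝ] A₁) (β₀ : B₀ →L[ℝ] A₀) (R : A₀ →L[ℝ] A₁) (S : B₀ →L[ℝ] B₁),
      (∀ u, β₀ (d' u) = d (β₁ u)) ∧
      (∀ v, R (d v) = β₁ (α₁ v) - v) ∧ (∀ w, d (R w) = β₀ (α₀ w) - w) ∧
      (∀ u, S (d' u) = α₁ (β₁ u) - u) ∧ (∀ z, d' (S z) = α₀ (β₀ z) - z) := by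
  let f : A₁ →ₗ[ℝ] A₀ × B₁ := (d : A₁ →ₗ[ℝ] A₀).prod (α₁ : A₁ →ₗ[ℝ] B₁)
  let g : A₀ × B₁ →ₗ[ℝ] B₀ := (α₀ : A₀ →ₗ[ℝ] B₀).coprod (-(d' : B₁ →ₗ[ℝ] B₀))
  have f_apply (v) : f v = (d v, α₁ v) := rfl
  have g_apply (w u) : g (w, u) = α₀ w - d' u := by
    simp [g, sub_eq_add_neg]
  obtain ⟨r₀, hr₀⟩ : ∃ r₀ : A₀ × B₁ →ₗ[ℝ] A₁, r₀ ∘ₗ f = LinearMap.id := by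
    apply LinearMap.exists_leftInverse_of_injective
    rw [LinearMap.ker_eq_bot']
    intro v hv
    rw [f_apply, Prod.mk_eq_zero] at hv
    exact h.eq_zero_of_map_eq_zero hv.1 hv.2
  obtain ⟨s, hs⟩ : ∃ s : B₀ →ₗ[ℝ] A₀ × B₁, g ∘ₗ s = LinearMap.id := by
    apply LinearMap.exists_rightInverse_of_surjective
    rw [LinearMap.range_eq_top]
    intro z
    obtain ⟨w, u, e⟩ := h.exists_preimage_add_boundary z
    exact ⟨(w, u), (g_apply w u).trans e⟩
  have hr₀ (v) : r₀ (f v) = v := LinearMap.congr_fun hr₀ v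
  have hs (z) : g (s z) = z := LinearMap.congr_fun hs z
  have exact_mid (p) (hp : g p = 0) : ∃ v, f v = p := by
    obtain ⟨w, u⟩ := p
    rw [g_apply, sub_eq_zero] at hp
    obtain ⟨v, rfl⟩ := h.exists_boundary hp
    rw [comm] at hp
    obtain ⟨k, hk, hk'⟩ := h.exists_preimage_of_mem_ker (u := u - α₁ v)
      (by rw [map_sub, hp, sub_self])
    refine ⟨v + k, ?_⟩
    rw [f_apply, map_add, map_add, hk, hk', add_zero, add_sub_cancel]
  -- the retraction of `f` which vanishes on the image of `s`
  let r : A₀ × B₁ →ₗ[ℝ] A₁ := r₀ ∘ₗ (LinearMap.id - s ∘ₗ g)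
  have r_apply (p) : r p = r₀ (p - s (g p)) := rfl
  have rf (v) : r (f v) = v := by
    have : g (f v) = 0 := by rw [f_apply, g_apply, comm, sub_self]
    rw [r_apply, this, map_zero, sub_zero, hr₀]
  have fr (p) : f (r p) = p - s (g p) := by
    obtain ⟨v, hv⟩ := exact_mid (p - s (g p)) (by rw [map_sub, hs, sub_self])
    rw [r_apply, ← hv, hr₀]
  have split (v u) : r (v, u) = r (v, 0) + r (0, u) := by
    rw [← map_add, Prod.mk_add_mk, add_zero, zero_add]
  refine ⟨LinearMap.toContinuousLinearMap (r ∘ₗ LinearMap.inr ℝ A₀ B₁),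
    LinearMap.toContinuousLinearMap (LinearMap.fst ℝ A₀ B₁ ∘ₗ s),
    LinearMap.toContinuousLinearMap (-(r ∘ₗ LinearMap.inl ℝ A₀ B₁)),
    LinearMap.toContinuousLinearMap (LinearMap.snd ℝ A₀ B₁ ∘ₗ s), ?_, ?_, ?_, ?_, ?_⟩
  · intro u
    have e := congrArg Prod.fst (fr (0, u))
    simp only [f_apply, g_apply, map_zero, zero_sub, map_neg, sub_neg_eq_add] at e
    simpa using e.symm
  · intro v
    have e := rf v
    rw [f_apply, split] at e
    simp only [LinearMap.coe_toContinuousLinearMap', LinearMap.neg_apply, LinearMap.comp_apply,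
      LinearMap.inl_apply, LinearMap.inr_apply]
    rw [neg_eq_iff_add_eq_zero, ← add_sub_assoc, e, sub_self]
  · intro w
    have e := congrArg Prod.fst (fr (w, 0))
    simp only [f_apply, g_apply, map_zero, sub_zero] at e
    change d (-(r (w, 0))) = (s (α₀ w)).1 - w
    rw [map_neg, e, Prod.fst_sub, neg_sub]
  · intro u
    have e := congrArg Prod.snd (fr (0, u))
    simp only [f_apply, g_apply, map_zero, zero_sub, map_neg, sub_neg_eq_add] at e
    simp only [LinearMap.coe_toContinuousLinearMap', LinearMap.comp_apply,
      LinearMap.inr_apply, LinearMap.snd_apply]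
    rw [e, Prod.snd_add, add_sub_cancel_left]
  · intro z
    have e := hs z
    rw [← Prod.mk.eta (p := s z), g_apply] at e
    simp only [LinearMap.coe_toContinuousLinearMap', LinearMap.comp_apply,
      LinearMap.fst_apply, LinearMap.snd_apply]
    nth_rewrite 3 [← e]
    rw [sub_sub_cancel]

end IsQuasiIso

/-! ### Smooth families of linear maps as smooth maps to a Hom bundle -/

section SmoothAlong

variable {EN HN N EP HP P : Type*}
  [NormedAddCommGroup EN] [NormedSpace ℝ EN] [TopologicalSpace HN]
  [TopologicalSpace N] [ChartedSpace HN N]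
  [NormedAddCommGroup EP] [NormedSpace ℝ EP] [TopologicalSpace HP]
  [TopologicalSpace P] [ChartedSpace HP P]
  {I : ModelWithCorners ℝ EN HN} {J : ModelWithCorners ℝ EP HP} {X : Type*}

/-- Smoothness along `ι` in terms of germs of local extensions. -/
theorem smoothAlong_iff_eventually {ι : X → N} {f : X → P} :
    SmoothAlong I J ι f ↔ ∀ x : X, ∃ g : N → P, ∀ᶠ n in 𝓝 (ι x),
      ContMDiffAt I J ∞ g n ∧ ∀ y : X, ι y = n → g n = f y := by
  refine forall_congr' fun x => ⟨?_, ?_⟩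
  · rintro ⟨U, g, hU, hx, hg, e⟩
    refine ⟨g, ?_⟩
    filter_upwards [hU.mem_nhds hx] with n hn
    exact ⟨(hg n hn).contMDiffAt (hU.mem_nhds hn), by rintro y rfl; exact e y hn⟩
  · rintro ⟨g, h⟩
    obtain ⟨U, hU, hUo, hx⟩ := eventually_nhds_iff.1 h
    exact ⟨U, g, hUo, hx, fun n hn => (hU n hn).1.contMDiffWithinAt,
      fun y hy => (hU _ hy).2 y rfl⟩

theorem smoothAlong_id_iff {f : N → P} :
    SmoothAlong I J (fun n : N => n) f ↔ ContMDiff I J ∞ f := by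
  refine ⟨fun h x => ?_, fun h => SmoothAlong.of_contMDiff _ h⟩
  obtain ⟨g, hg⟩ := smoothAlong_iff_eventually.1 h x
  refine hg.self_of_nhds.1.congr_of_eventuallyEq ?_
  filter_upwards [hg] with n hn
  exact (hn.2 n rfl).symm

end SmoothAlong

namespace TwoTerm

section HomBundle

variable {EM M : Type*} [NormedAddCommGroup EM] [NormedSpace ℝ EM]
  [TopologicalSpace M] [ChartedSpace EM M]
  {EN HN N : Type*} [NormedAddCommGroup EN] [NormedSpace ℝ EN] [TopologicalSpace HN]
  [TopologicalSpace N] [ChartedSpace HN N] {I : ModelWithCorners ℝ EN HN}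
  {FA : Type*} [NormedAddCommGroup FA] [NormedSpace ℝ FA]
  {A : M → Type*} [∀ x, AddCommGroup (A x)] [∀ x, Module ℝ (A x)] [∀ x, TopologicalSpace (A x)]
  [TopologicalSpace (TotalSpace FA A)] [FiberBundle FA A] [VectorBundle ℝ FA A]
  [∀ x, IsTopologicalAddGroup (A x)] [∀ x, ContinuousSMul ℝ (A x)]
  {FB : Type*} [NormedAddCommGroup FB] [NormedSpace ℝ FB]
  {B : M → Type*} [∀ x, AddCommGroup (B x)] [∀ x, Module ℝ (B x)] [∀ x, TopologicalSpace (B x)]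
  [TopologicalSpace (TotalSpace FB B)] [FiberBundle FB B] [VectorBundle ℝ FB B]
  [∀ x, IsTopologicalAddGroup (B x)] [∀ x, ContinuousSMul ℝ (B x)]

theorem contMDiffVectorBundle_pullback_fst [ContMDiffVectorBundle ∞ FA A 𝓘(ℝ, EM)] :
    ContMDiffVectorBundle ∞ FA ((ContinuousMap.fst : C(M × M, M)) *ᵖ A)
      (𝓘(ℝ, EM).prod 𝓘(ℝ, EM)) :=
  ContMDiffVectorBundle.pullback (IB := 𝓘(ℝ, EM)) FA A (𝓘(ℝ, EM).prod 𝓘(ℝ, EM))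
    (ContMDiffMap.fst : C^∞⟮𝓘(ℝ, EM).prod 𝓘(ℝ, EM), M × M; 𝓘(ℝ, EM), M⟯)

theorem contMDiffVectorBundle_pullback_snd [ContMDiffVectorBundle ∞ FA A 𝓘(ℝ, EM)] :
    ContMDiffVectorBundle ∞ FA ((ContinuousMap.snd : C(M × M, M)) *ᵖ A)
      (𝓘(ℝ, EM).prod 𝓘(ℝ, EM)) :=
  ContMDiffVectorBundle.pullback (IB := 𝓘(ℝ, EM)) FA A (𝓘(ℝ, EM).prod 𝓘(ℝ, EM))
    (ContMDiffMap.snd : C^∞⟮𝓘(ℝ, EM).prod 𝓘(ℝ, EM), M × M; 𝓘(ℝ, EM), M⟯)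

variable [ContMDiffVectorBundle ∞ FA A 𝓘(ℝ, EM)] [ContMDiffVectorBundle ∞ FB B 𝓘(ℝ, EM)]

theorem contMDiffAt_homTotal_iff {h : N → HomTotal FA FB A B} {n : N} {x₀ y₀ : M}
    (hx : (h n).1.1 ∈ (trivializationAt FA A x₀).baseSet)
    (hy : (h n).1.2 ∈ (trivializationAt FB B y₀).baseSet) :
    ContMDiffAt I ((𝓘(ℝ, EM).prod 𝓘(ℝ, EM)).prod 𝓘(ℝ, FA →L[ℝ] FB)) ∞ h n ↔
      ContMDiffAt I 𝓘(ℝ, EM) ∞ (fun n => (h n).1.1) n ∧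
      ContMDiffAt I 𝓘(ℝ, EM) ∞ (fun n => (h n).1.2) n ∧
      ContMDiffAt I 𝓘(ℝ, FA →L[ℝ] FB) ∞ (fun n => ContinuousLinearMap.inCoordinates
        FA A FB B x₀ (h n).1.1 y₀ (h n).1.2 (h n).2) n := by
  have := contMDiffVectorBundle_pullback_fst (EM := EM) (FA := FA) (A := A)
  have := contMDiffVectorBundle_pullback_snd (EM := EM) (FA := FB) (A := B)
  set t := trivializationAt (FA →L[ℝ] FB) (HomBundle A B) (x₀, y₀) with ht
  have hmem : h n ∈ t.source := by
    rw [t.mem_source, ht, hom_trivializationAt_baseSet]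
    exact ⟨hx, hy⟩
  have hc : (fun n => (t (h n)).2) = fun n => ContinuousLinearMap.inCoordinates
      FA A FB B x₀ (h n).1.1 y₀ (h n).1.2 (h n).2 := by
    funext n
    rw [ht, hom_trivializationAt_apply]
    exact inCoordinates_pullback (x₀, y₀) (h n).1 (h n).2
  rw [Trivialization.contMDiffAt_iff (IB := 𝓘(ℝ, EM).prod 𝓘(ℝ, EM)) (e := t) hmem, hc]
  exact ⟨fun H => ⟨H.1.fst, H.1.snd, H.2⟩, fun H => ⟨H.1.prodMk H.2.1, H.2.2⟩⟩

variable {X : Type*} {ι : X → N} {a b : X → M} {T : ∀ i, A (a i) →L[ℝ] B (b i)}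

/-- The smoothness of `i ↦ T i` as a map to the total space of the Hom bundle is obtained from
that of `(i, v) ↦ T i v`: the matrix of `T` in local frames has as columns the images under `T`
of the (finitely many) frame sections. -/
theorem SmoothFamily.smoothAlong_homMk [FiniteDimensional ℝ FA]
    (hT : SmoothFamily (EM := EM) FA FB I ι a b T) (ha : SmoothAlong I 𝓘(ℝ, EM) ι a)
    (hb : SmoothAlong I 𝓘(ℝ, EM) ι b) :
    SmoothAlong I ((𝓘(ℝ, EM).prod 𝓘(ℝ, EM)).prod 𝓘(ℝ, FA →L[ℝ] FB)) ι
      (fun i => homMk FA FB (T i)) := by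
  rw [smoothAlong_iff_eventually] at ha hb ⊢
  intro x
  obtain ⟨a', ha⟩ := ha x
  obtain ⟨b', hb⟩ := hb x
  have eax : a' (ι x) = a x := ha.self_of_nhds.2 x rfl
  have ebx : b' (ι x) = b x := hb.self_of_nhds.2 x rfl
  set tA := trivializationAt FA A (a x) with htA
  set tB := trivializationAt FB B (b x) with htB
  have hax : a x ∈ tA.baseSet := FiberBundle.mem_baseSet_trivializationAt' (a x)
  have hbx : b x ∈ tB.baseSet := FiberBundle.mem_baseSet_trivializationAt' (b x)
  have ha1 : ∀ᶠ n in 𝓝 (ι x), a' n ∈ tA.baseSet :=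
    ha.self_of_nhds.1.continuousAt.eventually (tA.open_baseSet.mem_nhds (by rwa [eax]))
  have hb1 : ∀ᶠ n in 𝓝 (ι x), b' n ∈ tB.baseSet :=
    hb.self_of_nhds.1.continuousAt.eventually (tB.open_baseSet.mem_nhds (by rwa [ebx]))
  let e := Module.finBasis ℝ FA
  -- the frame sections along `a'`
  let σ (j) (n : N) : N × TotalSpace FA A :=
    (n, tA.toOpenPartialHomeomorph.symm (a' n, e j))
  have hσ : ∀ᶠ n in 𝓝 (ι x), ∀ j,
      ContMDiffAt I (I.prod (𝓘(ℝ, EM).prod 𝓘(ℝ, FA))) ∞ (σ j) n := by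
    filter_upwards [ha, ha1] with n hn hn1 j
    have hmem : (a' n, e j) ∈ tA.target := by rwa [tA.mem_target]
    exact contMDiffAt_id.prodMk
      (((tA.contMDiffOn_symm (IB := 𝓘(ℝ, EM)) (n := ∞)).contMDiffAt
        (tA.open_target.mem_nhds hmem)).comp n (hn.1.prodMk contMDiffAt_const))
  have eσ (j) (y : X) (h1 : a' (ι y) = a y) (h2 : a' (ι y) ∈ tA.baseSet) :
      σ j (ι y) = (ι y, (⟨a y, tA.symm (a y) (e j)⟩ : TotalSpace FA A)) := by
    rw [h1] at h2
    refine Prod.ext rfl ?_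
    simp only [σ, h1]
    exact (tA.mk_symm h2 (e j)).symm
  choose G hG using fun j =>
    smoothAlong_iff_eventually.1 hT ⟨x, tA.symm (a x) (e j)⟩
  have hσx (j) : ContinuousAt (σ j) (ι x) := (hσ.self_of_nhds j).continuousAt
  have hGσ : ∀ᶠ n in 𝓝 (ι x), ∀ j,
      ContMDiffAt (I.prod (𝓘(ℝ, EM).prod 𝓘(ℝ, FA))) (𝓘(ℝ, EM).prod 𝓘(ℝ, FB)) ∞ (G j) (σ j n) ∧
      ∀ y : Σ i : X, A (a i), (ι y.1, (⟨a y.1, y.2⟩ : TotalSpace FA A)) = σ j n →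
        G j (σ j n) = ⟨b y.1, T y.1 y.2⟩ := by
    rw [Filter.eventually_all]
    intro j
    have h : ∀ᶠ q in 𝓝 (σ j (ι x)),
        ContMDiffAt (I.prod (𝓘(ℝ, EM).prod 𝓘(ℝ, FA))) (𝓘(ℝ, EM).prod 𝓘(ℝ, FB)) ∞ (G j) q ∧
        ∀ y : Σ i : X, A (a i), (ι y.1, (⟨a y.1, y.2⟩ : TotalSpace FA A)) = q →
          G j q = ⟨b y.1, T y.1 y.2⟩ := by
      rw [eσ j x eax (by rwa [eax])]
      exact hG j
    exact (hσx j).eventually h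
  have hGs : ∀ᶠ n in 𝓝 (ι x), ∀ j, G j (σ j n) ∈ tB.source := by
    rw [Filter.eventually_all]
    intro j
    have hc : ContinuousAt (fun n => G j (σ j n)) (ι x) :=
      ContinuousAt.comp (hGσ.self_of_nhds j).1.continuousAt (hσx j)
    refine hc.eventually (tB.open_source.mem_nhds ?_)
    change G j (σ j (ι x)) ∈ tB.source
    rw [(hGσ.self_of_nhds j).2 ⟨x, tA.symm (a x) (e j)⟩ (eσ j x eax (by rwa [eax])).symm,
      tB.mem_source]
    exact hbx
  -- the matrix of `T` in local frames
  let m (n : N) : FA →L[ℝ] FB :=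
    ∑ j, (LinearMap.toContinuousLinearMap (e.coord j)).smulRight (tB (G j (σ j n))).2
  have m_apply (n : N) (j) : m n (e j) = (tB (G j (σ j n))).2 := by
    simp only [m, sum_apply, ContinuousLinearMap.smulRight_apply,
      LinearMap.coe_toContinuousLinearMap', Module.Basis.coord_apply, Module.Basis.repr_self]
    rw [Finset.sum_eq_single j]
    · simp
    · intro k _ hk
      simp [hk.symm]
    · simp
  have hm : ∀ᶠ n in 𝓝 (ι x), ContMDiffAt I 𝓘(ℝ, FA →L[ℝ] FB) ∞ m n := by
    filter_upwards [hσ, hGσ, hGs] with n h1 h2 h3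
    refine contMDiffAt_finsetSum fun j _ => ?_
    have h4 : ContMDiffAt I (𝓘(ℝ, EM).prod 𝓘(ℝ, FB)) ∞ (fun n => tB (G j (σ j n))) n :=
      ((tB.contMDiffOn (IB := 𝓘(ℝ, EM)) (n := ∞)).contMDiffAt
        (tB.open_source.mem_nhds (h3 j))).comp n ((h2 j).1.comp n (h1 j))
    exact (ContinuousLinearMap.smulRightL ℝ FA FB
      (LinearMap.toContinuousLinearMap (e.coord j))).contMDiff.contMDiffAt.comp n h4.snd
  refine ⟨fun n => homMk FA FB (((tB.symmL ℝ (b' n)).comp (m n)).comp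
    (tA.continuousLinearMapAt ℝ (a' n))), ?_⟩
  filter_upwards [ha.and ha1.eventually_nhds, hb.and hb1.eventually_nhds, hm, hGσ] with
    n hn hn' hmn hGn
  constructor
  · refine (contMDiffAt_homTotal_iff (x₀ := a x) (y₀ := b x) hn.2.self_of_nhds
      hn'.2.self_of_nhds).2 ⟨hn.1.1, hn'.1.1, hmn.congr_of_eventuallyEq ?_⟩
    filter_upwards [hn.2, hn'.2] with n hn hn'
    ext v
    change tB.continuousLinearMapAt ℝ (b' n) (tB.symmL ℝ (b' n)
      (m n (tA.continuousLinearMapAt ℝ (a' n) (tA.symmL ℝ (a' n) v)))) = m n v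
    rw [tB.continuousLinearMapAt_symmL hn', tA.continuousLinearMapAt_symmL hn]
  · rintro y rfl
    have h1 := hn.1.2 y rfl
    have h2 := hn'.1.2 y rfl
    have key (p q : M) (hp : p = a y) (hq : q = b y) (hpA : p ∈ tA.baseSet)
        (hqB : q ∈ tB.baseSet) :
        homMk FA FB (((tB.symmL ℝ q).comp (m (ι y))).comp (tA.continuousLinearMapAt ℝ p)) =
          homMk FA FB (T y) := by
      subst hp hq
      congr 1
      ext v
      obtain ⟨c, rfl⟩ : ∃ c, v = tA.symmL ℝ (a y) c :=
        ⟨_, (tA.symmL_continuousLinearMapAt hpA v).symm⟩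
      simp only [ContinuousLinearMap.comp_apply]
      rw [tA.continuousLinearMapAt_symmL hpA]
      suffices h : (tB.symmL ℝ (b y)).comp (m (ι y)) = (T y).comp (tA.symmL ℝ (a y)) from
        DFunLike.congr_fun h c
      apply ContinuousLinearMap.coe_injective
      refine e.ext fun j => ?_
      simp only [ContinuousLinearMap.coe_coe, ContinuousLinearMap.comp_apply]
      rw [m_apply, (hGn j).2 ⟨y, tA.symm (a y) (e j)⟩ (eσ j y h1 (by rwa [h1])).symm]
      rw [tB.symmL_apply hqB, tA.symmL_apply hpA]
      exact tB.symm_apply_apply_mk hqB (T y (tA.symm (a y) (e j)))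
    exact key _ _ h1 h2 hn.2.self_of_nhds hn'.2.self_of_nhds

/-- The converse of `SmoothFamily.smoothAlong_homMk`. Off `X` the base point of a vector `v` need
not be the source of the linear map which locally extends `i ↦ T i`; the map on the fibre product is
therefore extended by applying the matrix of the latter to the coordinates of `v`. -/
theorem SmoothAlong.smoothFamily
    (hT : SmoothAlong I ((𝓘(ℝ, EM).prod 𝓘(ℝ, EM)).prod 𝓘(ℝ, FA →L[ℝ] FB)) ι
      (fun i => homMk FA FB (T i))) :
    SmoothFamily (EM := EM) FA FB I ι a b T := by
  unfold SmoothFamily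
  rw [smoothAlong_iff_eventually] at hT ⊢
  rintro ⟨x, v⟩
  obtain ⟨h, hh⟩ := hT x
  have ehx : h (ι x) = homMk FA FB (T x) := hh.self_of_nhds.2 x rfl
  set tA := trivializationAt FA A (a x) with htA
  set tB := trivializationAt FB B (b x) with htB
  have hax : a x ∈ tA.baseSet := FiberBundle.mem_baseSet_trivializationAt' (a x)
  have hbx : b x ∈ tB.baseSet := FiberBundle.mem_baseSet_trivializationAt' (b x)
  have hproj : ContinuousAt (fun n => (h n).1) (ι x) :=
    (FiberBundle.continuous_proj (FA →L[ℝ] FB) (HomBundle A B)).continuousAt.comp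
      hh.self_of_nhds.1.continuousAt
  have h1 : ∀ᶠ n in 𝓝 (ι x), (h n).1.1 ∈ tA.baseSet :=
    (continuous_fst.continuousAt.comp hproj).eventually
      (tA.open_baseSet.mem_nhds (by rwa [Function.comp, ehx]))
  have h2 : ∀ᶠ n in 𝓝 (ι x), (h n).1.2 ∈ tB.baseSet :=
    (continuous_snd.continuousAt.comp hproj).eventually
      (tB.open_baseSet.mem_nhds (by rwa [Function.comp, ehx]))
  let m (n : N) : FA →L[ℝ] FB := ContinuousLinearMap.inCoordinates
        FA A FB B (a x) (h n).1.1 (b x) (h n).1.2 (h n).2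
  refine ⟨fun q => tB.toOpenPartialHomeomorph.symm ((h q.1).1.2, m q.1 (tA q.2).2), ?_⟩
  have hv : ∀ᶠ w in 𝓝 (⟨a x, v⟩ : TotalSpace FA A), w ∈ tA.source :=
    tA.open_source.mem_nhds (by rw [tA.mem_source]; exact hax)
  rw [nhds_prod_eq]
  filter_upwards [(hh.and (h1.and h2)).prod_mk hv] with ⟨n, w⟩ ⟨⟨hn, hn1, hn2⟩, hw⟩
  dsimp only at hn hn1 hn2 hw ⊢
  constructor
  · obtain ⟨-, s2, s3⟩ := (contMDiffAt_homTotal_iff hn1 hn2).1 hn.1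
    have hmem : ((h n).1.2, m n (tA w).2) ∈ tB.target := by rwa [tB.mem_target]
    have s4 : ContMDiffAt (I.prod (𝓘(ℝ, EM).prod 𝓘(ℝ, FA))) (𝓘(ℝ, EM).prod 𝓘(ℝ, FA)) ∞
        (fun q : N × TotalSpace FA A => tA q.2) (n, w) :=
      ContMDiffAt.comp (n, w) ((tA.contMDiffOn (IB := 𝓘(ℝ, EM)) (n := ∞)).contMDiffAt
        (tA.open_source.mem_nhds hw)) contMDiffAt_snd
    have s5 : ContMDiffAt (I.prod (𝓘(ℝ, EM).prod 𝓘(ℝ, FA))) 𝓘(ℝ, FA →L[ℝ] FB) ∞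
        (fun q : N × TotalSpace FA A => m q.1) (n, w) :=
      ContMDiffAt.comp (g := m) (f := Prod.fst) (n, w) s3 contMDiffAt_fst
    have s6 : ContMDiffAt (I.prod (𝓘(ℝ, EM).prod 𝓘(ℝ, FA))) 𝓘(ℝ, EM) ∞
        (fun q : N × TotalSpace FA A => (h q.1).1.2) (n, w) :=
      ContMDiffAt.comp (g := fun n => (h n).1.2) (f := Prod.fst) (n, w) s2 contMDiffAt_fst
    exact ((tB.contMDiffOn_symm (IB := 𝓘(ℝ, EM)) (n := ∞)).contMDiffAt
      (tB.open_target.mem_nhds hmem)).comp (n, w) (s6.prodMk (s5.clm_apply s4.snd))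
  · rintro ⟨y, u⟩ e
    obtain ⟨rfl, rfl⟩ := Prod.mk.inj e
    have ey := hn.2 y rfl
    simp only [m]
    rw [ey] at hn1 hn2 ⊢
    simp only [homMk] at hn1 hn2 ⊢
    rw [← tB.mk_symm hn2]
    congr 1
    change tB.symm (b y) (tB.continuousLinearMapAt ℝ (b y)
      (T y (tA.symmL ℝ (a y) (tA ⟨a y, u⟩).2))) = T y u
    rw [← tB.symmL_apply (R := ℝ) hn2, tB.symmL_continuousLinearMapAt hn2, tA.symmL_apply hn1,
      tA.symm_apply_apply_mk hn1]

/-- Sections of the bundle `[A, B]` over `M` and families over the diagonal of `M × M` have the same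
smoothness. -/
theorem contMDiff_homSection_iff {T : ∀ x, A x →L[ℝ] B x} :
    ContMDiff 𝓘(ℝ, EM) (𝓘(ℝ, EM).prod 𝓘(ℝ, FA →L[ℝ] FB)) ∞
      (fun x => (⟨x, T x⟩ : TotalSpace (FA →L[ℝ] FB) (fun x : M => A x →L[ℝ] B x))) ↔
    ContMDiff 𝓘(ℝ, EM) ((𝓘(ℝ, EM).prod 𝓘(ℝ, EM)).prod 𝓘(ℝ, FA →L[ℝ] FB)) ∞
      (fun x => homMk FA FB (T x)) := by
  refine forall_congr' fun x => ?_
  rw [contMDiffAt_homMk_iff, contMDiffAt_hom_bundle]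
  exact ⟨fun h => ⟨h.1, h.1, h.2⟩, fun h => h.2⟩

/-- A fibrewise linear map `A → B` is smooth on total spaces iff it is smooth as a family over the
diagonal of `M × M`. -/
theorem contMDiff_bundleMap_iff [FiniteDimensional ℝ FA] {T : ∀ x, A x →L[ℝ] B x} :
    ContMDiff (𝓘(ℝ, EM).prod 𝓘(ℝ, FA)) (𝓘(ℝ, EM).prod 𝓘(ℝ, FB)) ∞
      (fun v : TotalSpace FA A => (⟨v.1, T v.1 v.2⟩ : TotalSpace FB B)) ↔
    ContMDiff 𝓘(ℝ, EM) ((𝓘(ℝ, EM).prod 𝓘(ℝ, EM)).prod 𝓘(ℝ, FA →L[ℝ] FB)) ∞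
      (fun x => homMk FA FB (T x)) := by
  have hid : SmoothAlong 𝓘(ℝ, EM) 𝓘(ℝ, EM) (fun x : M => x) (fun x => x) :=
    smoothAlong_id_iff.2 contMDiff_id
  constructor
  · intro h
    refine smoothAlong_id_iff.1 (SmoothFamily.smoothAlong_homMk (T := T) ?_ hid hid)
    exact SmoothAlong.of_contMDiff (fun p : Σ x : M, A x => (p.1, (⟨p.1, p.2⟩ : TotalSpace FA A)))
      (h.comp contMDiff_snd)
  · intro h
    have h1 : SmoothFamily (EM := EM) FA FB 𝓘(ℝ, EM) (fun x : M => x) (fun x => x) (fun x => x) T :=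
      SmoothAlong.smoothFamily (smoothAlong_id_iff.2 h)
    refine smoothAlong_id_iff.1 (SmoothAlong.comp h1
      (u := fun v : TotalSpace FA A => (⟨v.1, v.2⟩ : Σ x : M, A x)) ?_)
    exact smoothAlong_id_iff.2 ((contMDiff_proj A).prodMk contMDiff_id)

end HomBundle

end TwoTerm

/-! ### Normalization of representations up to homotopy -/

namespace TwoTerm

section Normalization

variable {EM EG : Type*} {M : Type*} [NormedAddCommGroup EM] [NormedSpace ℝ EM]
  [NormedAddCommGroup EG] [NormedSpace ℝ EG]
  [Groupoid M] [TopologicalSpace M] [ChartedSpace EM M]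
  [TopologicalSpace (Quiver.Total M)] [ChartedSpace EG (Quiver.Total M)]
  {F₁ : Type*} [NormedAddCommGroup F₁] [NormedSpace ℝ F₁]
  {F₀ : Type*} [NormedAddCommGroup F₀] [NormedSpace ℝ F₀]
  {V₁ : M → Type*} [∀ x, AddCommGroup (V₁ x)] [∀ x, Module ℝ (V₁ x)]
  [∀ x, TopologicalSpace (V₁ x)] [∀ x, IsTopologicalAddGroup (V₁ x)]
  [∀ x, ContinuousSMul ℝ (V₁ x)]
  [TopologicalSpace (TotalSpace F₁ V₁)] [FiberBundle F₁ V₁] [VectorBundle ℝ F₁ V₁]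
  [ContMDiffVectorBundle ∞ F₁ V₁ 𝓘(ℝ, EM)]
  {V₀ : M → Type*} [∀ x, AddCommGroup (V₀ x)] [∀ x, Module ℝ (V₀ x)]
  [∀ x, TopologicalSpace (V₀ x)] [∀ x, IsTopologicalAddGroup (V₀ x)]
  [∀ x, ContinuousSMul ℝ (V₀ x)]
  [TopologicalSpace (TotalSpace F₀ V₀)] [FiberBundle F₀ V₀] [VectorBundle ℝ F₀ V₀]
  [ContMDiffVectorBundle ∞ F₀ V₀ 𝓘(ℝ, EM)]

theorem contMDiff_neg_bundleMap :
    ContMDiff (𝓘(ℝ, EM).prod 𝓘(ℝ, F₁)) (𝓘(ℝ, EM).prod 𝓘(ℝ, F₁)) ∞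
      (fun v : TotalSpace F₁ V₁ => (⟨v.1, -v.2⟩ : TotalSpace F₁ V₁)) := by
  intro v
  set t := trivializationAt F₁ V₁ v.1
  have hv : v ∈ t.source :=
    t.mem_source.2 (FiberBundle.mem_baseSet_trivializationAt' v.1)
  have hv' : (⟨v.1, -v.2⟩ : TotalSpace F₁ V₁) ∈ t.source :=
    t.mem_source.2 (FiberBundle.mem_baseSet_trivializationAt' v.1)
  refine (t.contMDiffAt_iff (IB := 𝓘(ℝ, EM)) (f := fun v : TotalSpace F₁ V₁ => ⟨v.1, -v.2⟩)
    (x₀ := v) hv').2 ⟨contMDiffAt_proj V₁, ?_⟩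
  have h : ContMDiffAt (𝓘(ℝ, EM).prod 𝓘(ℝ, F₁)) 𝓘(ℝ, F₁) ∞
      (fun w : TotalSpace F₁ V₁ => -(t w).2) v :=
    ((t.contMDiffOn (IB := 𝓘(ℝ, EM)) (n := ∞)).contMDiffAt (t.open_source.mem_nhds hv)).snd.neg
  refine h.congr_of_eventuallyEq ?_
  filter_upwards [t.open_source.mem_nhds hv] with w hw
  exact (t.linear ℝ (t.mem_source.1 hw)).map_neg w.2

namespace RepUpToHomotopy

/-- A representation up to homotopy is normalized if its curvature vanishes on pairs of units.
The pseudo-functors considered here are strictly unitary, and correspond to the normalized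
representations; the normalization is not part of the definition of `RepUpToHomotopy`. -/
def IsNormalized [IsLieGroupoid EM EG M] : ObjectProperty (RepUpToHomotopy EM EG F₁ F₀ V₁ V₀) :=
  fun E => ∀ x : M, E.γ (𝟙 x) (𝟙 x) = 0

variable (E : RepUpToHomotopy EM EG F₁ F₀ V₁ V₀)

theorem γ_id_left {x y : M} (g : x ⟶ y) (w : V₀ x) :
    E.γ (𝟙 x) g w = E.ρ₁ g (E.γ (𝟙 x) (𝟙 x) w) := by
  have h := E.cocycle (𝟙 x) (𝟙 x) g w
  rw [E.ρ₀_id, Category.id_comp, Category.id_comp] at h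
  simp only [ContinuousLinearMap.id_apply] at h
  rw [sub_add_cancel, sub_eq_zero] at h
  exact h.symm

theorem γ_id_right {x y : M} (g : x ⟶ y) (w : V₀ x) :
    E.γ g (𝟙 y) w = E.γ (𝟙 y) (𝟙 y) (E.ρ₀ g w) := by
  have h := E.cocycle g (𝟙 y) (𝟙 y) w
  rw [E.ρ₁_id, Category.comp_id, Category.comp_id] at h
  simp only [ContinuousLinearMap.id_apply] at h
  rw [sub_self, zero_add, sub_eq_zero] at h
  exact h

theorem γ_id_left_d {x y : M} (g : x ⟶ y) (v : V₁ x) : E.γ (𝟙 x) g (E.d x v) = 0 := by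
  rw [E.γ_d, Category.id_comp, E.ρ₁_id, ContinuousLinearMap.id_apply, sub_self]

theorem d_γ_id_left {x y : M} (g : x ⟶ y) (w : V₀ x) : E.d y (E.γ (𝟙 x) g w) = 0 := by
  rw [E.d_γ, Category.id_comp, E.ρ₀_id, ContinuousLinearMap.id_apply, sub_self]

theorem γ_id_comp {x y z : M} (g : x ⟶ y) (h : y ⟶ z) (w : V₀ x) :
    E.γ (𝟙 x) (g ≫ h) w = E.ρ₁ h (E.γ (𝟙 x) g w) := by
  have e := E.cocycle (𝟙 x) g h w
  rw [E.ρ₀_id, Category.id_comp, ContinuousLinearMap.id_apply, add_sub_cancel_right,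
    sub_eq_zero] at e
  exact e.symm

variable [IsLieGroupoid EM EG M]

theorem smoothFamily_γ_id_left :
    SmoothFamily (EM := EM) F₀ F₁ 𝓘(ℝ, EG) (fun g : Quiver.Total M => g)
      (fun g => g.left) (fun g => g.right) (fun g => E.γ (𝟙 g.left) g.hom) := by
  have hL : ContMDiff 𝓘(ℝ, EG) 𝓘(ℝ, EG) ∞
      (fun g : Quiver.Total M => (⟨g.left, g.left, 𝟙 g.left⟩ : Quiver.Total M)) :=
    (IsLieGroupoid.smooth_unit (EM := EM) (EG := EG) (M := M)).comp
      (IsLieGroupoid.submersion_source (EM := EM) (EG := EG) (M := M)).contMDiff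
  exact SmoothAlong.comp E.smooth_γ
    (u := fun p : Σ g : Quiver.Total M, V₀ g.left => ⟨⟨𝟙 p.1.left, p.1.hom⟩, p.2⟩)
    (SmoothAlong.of_contMDiff
      (fun p : Σ g : Quiver.Total M, V₀ g.left => (p.1, (⟨p.1.left, p.2⟩ : TotalSpace F₀ V₀)))
      (((hL.comp contMDiff_fst).prodMk contMDiff_fst).prodMk contMDiff_snd))

theorem smoothFamily_γ_id_left_comp_ρ₀ :
    SmoothFamily (EM := EM) F₀ F₁ (𝓘(ℝ, EG).prod 𝓘(ℝ, EG)) ComposablePair.incl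
      (fun p : ComposablePair M => p.src) (fun p => p.tgt)
      (fun p => (E.γ (𝟙 p.mid) p.snd).comp (E.ρ₀ p.fst)) := by
  let κ : (Σ p : ComposablePair M, V₀ p.src) →
      (Quiver.Total M × Quiver.Total M) × TotalSpace F₀ V₀ :=
    fun p => (p.1.incl, ⟨p.1.src, p.2⟩)
  have h₁ : SmoothAlong ((𝓘(ℝ, EG).prod 𝓘(ℝ, EG)).prod (𝓘(ℝ, EM).prod 𝓘(ℝ, F₀))) 𝓘(ℝ, EG) κ
      (fun p => (⟨p.1.mid, p.1.tgt, p.1.snd⟩ : Quiver.Total M)) :=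
    SmoothAlong.of_contMDiff κ (contMDiff_snd.comp contMDiff_fst)
  have h₂ : SmoothAlong ((𝓘(ℝ, EG).prod 𝓘(ℝ, EG)).prod (𝓘(ℝ, EM).prod 𝓘(ℝ, F₀)))
      (𝓘(ℝ, EM).prod 𝓘(ℝ, F₀)) κ
      (fun p => (⟨p.1.mid, E.ρ₀ p.1.fst p.2⟩ : TotalSpace F₀ V₀)) :=
    SmoothAlong.comp E.smooth_ρ₀
      (u := fun p : Σ p : ComposablePair M, V₀ p.src => ⟨⟨p.1.src, p.1.mid, p.1.fst⟩, p.2⟩)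
      (SmoothAlong.of_contMDiff κ ((contMDiff_fst.comp contMDiff_fst).prodMk contMDiff_snd))
  exact SmoothAlong.comp E.smoothFamily_γ_id_left
    (u := fun p : Σ p : ComposablePair M, V₀ p.src =>
      ⟨⟨p.1.mid, p.1.tgt, p.1.snd⟩, E.ρ₀ p.1.fst p.2⟩) (h₁.prodMk h₂)

/-- The normalization of a representation up to homotopy: the maps `∂` and `ρ` are kept, and the
curvature is changed by the coboundary of the cochain `g ↦ -γ^{g,1}`, which simplifies to
`γ^{h,g} - γ^{h,1} ρ₀^g`. -/
def normalize : RepUpToHomotopy EM EG F₁ F₀ V₁ V₀ where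
  d := E.d
  ρ₁ := E.ρ₁
  ρ₀ := E.ρ₀
  γ {_ y _} g h := E.γ g h + -(E.γ (𝟙 y) h).comp (E.ρ₀ g)
  ρ₁_id := E.ρ₁_id
  ρ₀_id := E.ρ₀_id
  ρ_d := E.ρ_d
  γ_d {_ y _} g h v := by
    simp [E.γ_d, E.ρ_d, E.ρ₁_id]
  d_γ g h w := by
    simp [E.d_γ, E.ρ₀_id]
  cocycle {x y z t} g₁ g₂ g₃ w := by
    have e := E.cocycle g₁ g₂ g₃ w
    -- `γ^{g₃,1}` vanishes on the image of `∂`, so `ρ₀^{g₂g₁}` may be replaced by `ρ₀^{g₂} ρ₀^{g₁}`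
    have e₁ := E.γ_id_comp g₂ g₃ (E.ρ₀ g₁ w)
    have e₂ := congrArg (E.γ (𝟙 z) g₃) (E.d_γ g₁ g₂ w)
    rw [E.γ_id_left_d, map_sub] at e₂
    simp only [add_apply, neg_apply, ContinuousLinearMap.comp_apply, map_add, map_neg]
    linear_combination (norm := module) e + e₁ + e₂
  smooth_d := E.smooth_d
  smooth_ρ₁ := E.smooth_ρ₁
  smooth_ρ₀ := E.smooth_ρ₀
  smooth_γ := SmoothAlong.add_fiber E.smooth_γ
    (E.smoothFamily_γ_id_left_comp_ρ₀.postcomp contMDiff_neg_bundleMap)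

theorem isNormalized_normalize : IsNormalized E.normalize := by
  intro x
  ext w
  change E.γ (𝟙 x) (𝟙 x) w + -(E.γ (𝟙 x) (𝟙 x) (E.ρ₀ (𝟙 x) w)) = 0
  rw [E.ρ₀_id, ContinuousLinearMap.id_apply, add_neg_cancel]

/-- The isomorphism from a representation up to homotopy to its normalization has identity
components and homotopies `-γ^{g,1}`. -/
def isoNormalize : E ≅ E.normalize where
  hom :=
    { θ₁ := fun _ => ContinuousLinearMap.id ℝ _
      θ₀ := fun _ => ContinuousLinearMap.id ℝ _
      μ := fun {x _} g => -E.γ (𝟙 x) g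
      comm := fun _ _ => rfl
      quasiIso := fun _ => IsQuasiIso.refl _
      μ_d := fun g v => by
        change -(E.γ (𝟙 _) g (E.d _ v)) = E.ρ₁ g v - E.ρ₁ g v
        rw [E.γ_id_left_d, neg_zero, sub_self]
      d_μ := fun g w => by
        change E.d _ (-(E.γ (𝟙 _) g w)) = E.ρ₀ g w - E.ρ₀ g w
        rw [map_neg, E.d_γ_id_left, neg_zero, sub_self]
      coherence := fun {x y z} g h w => by
        change E.γ g h w + -(E.γ (𝟙 y) h (E.ρ₀ g w)) + E.ρ₁ h (-(E.γ (𝟙 x) g w)) -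
          -(E.γ (𝟙 x) (g ≫ h) w) - (E.γ g h w + -(E.γ (𝟙 y) h (E.ρ₀ g w))) = 0
        rw [E.γ_id_comp, map_neg]
        abel
      smooth_θ₁ := contMDiff_id
      smooth_θ₀ := contMDiff_id
      smooth_μ := E.smoothFamily_γ_id_left.postcomp contMDiff_neg_bundleMap }
  inv :=
    { θ₁ := fun _ => ContinuousLinearMap.id ℝ _
      θ₀ := fun _ => ContinuousLinearMap.id ℝ _
      μ := fun {x _} g => E.γ (𝟙 x) g
      comm := fun _ _ => rfl
      quasiIso := fun _ => IsQuasiIso.refl _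
      μ_d := fun g v => by
        change E.γ (𝟙 _) g (E.d _ v) = E.ρ₁ g v - E.ρ₁ g v
        rw [E.γ_id_left_d, sub_self]
      d_μ := fun g w => by
        change E.d _ (E.γ (𝟙 _) g w) = E.ρ₀ g w - E.ρ₀ g w
        rw [E.d_γ_id_left, sub_self]
      coherence := fun {x y z} g h w => by
        change E.γ g h w + -(E.γ (𝟙 y) h (E.ρ₀ g w)) + E.γ (𝟙 y) h (E.ρ₀ g w) +
          E.ρ₁ h (E.γ (𝟙 x) g w) - E.γ (𝟙 x) (g ≫ h) w - E.γ g h w = 0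
        rw [E.γ_id_comp]
        abel
      smooth_θ₁ := contMDiff_id
      smooth_θ₀ := contMDiff_id
      smooth_μ := E.smoothFamily_γ_id_left }
  hom_inv_id := RuthQuasiIso.ext' rfl rfl fun g => by
    ext w
    exact neg_add_cancel (E.γ (𝟙 _) g w)
  inv_hom_id := RuthQuasiIso.ext' rfl rfl fun g => by
    ext w
    exact add_neg_cancel (E.γ (𝟙 _) g w)

instance : (IsNormalized (EM := EM) (EG := EG) (F₁ := F₁) (F₀ := F₀) (V₁ := V₁)
    (V₀ := V₀)).ι.EssSurj where
  mem_essImage E := ⟨⟨E.normalize, E.isNormalized_normalize⟩, ⟨E.isoNormalize.symm⟩⟩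

end RepUpToHomotopy

end Normalization

end TwoTerm

namespace TwoTerm

section Comparison

variable {EM EG : Type*} {M : Type*} [NormedAddCommGroup EM] [NormedSpace ℝ EM]
  [NormedAddCommGroup EG] [NormedSpace ℝ EG]
  [Groupoid M] [TopologicalSpace M] [ChartedSpace EM M]
  [TopologicalSpace (Quiver.Total M)] [ChartedSpace EG (Quiver.Total M)]
  {F₁ : Type*} [NormedAddCommGroup F₁] [NormedSpace ℝ F₁]
  {F₀ : Type*} [NormedAddCommGroup F₀] [NormedSpace ℝ F₀]
  {V₁ : M → Type*} [∀ x, AddCommGroup (V₁ x)] [∀ x, Module ℝ (V₁ x)]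
  [∀ x, TopologicalSpace (V₁ x)] [∀ x, IsTopologicalAddGroup (V₁ x)]
  [∀ x, ContinuousSMul ℝ (V₁ x)]
  [TopologicalSpace (TotalSpace F₁ V₁)] [FiberBundle F₁ V₁] [VectorBundle ℝ F₁ V₁]
  [ContMDiffVectorBundle ∞ F₁ V₁ 𝓘(ℝ, EM)]
  {V₀ : M → Type*} [∀ x, AddCommGroup (V₀ x)] [∀ x, Module ℝ (V₀ x)]
  [∀ x, TopologicalSpace (V₀ x)] [∀ x, IsTopologicalAddGroup (V₀ x)]
  [∀ x, ContinuousSMul ℝ (V₀ x)]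
  [TopologicalSpace (TotalSpace F₀ V₀)] [FiberBundle F₀ V₀] [VectorBundle ℝ F₀ V₀]
  [ContMDiffVectorBundle ∞ F₀ V₀ 𝓘(ℝ, EM)]

/-! ### Invertibility in `GL(V)` -/

/-- Every 2-cell of `GL(V)` is invertible, with inverse `-R`. -/
def _root_.GLCell.toIso {a b : GLObj V₁ V₀} {α β : GLHom a b} (S : GLCell α β) : α ≅ β where
  hom := S
  inv :=
    { R := -S.R
      R_d := fun v => by simp [S.R_d]
      d_R := fun w => by simp [S.d_R] }
  hom_inv_id := GLCell.ext_R (add_neg_cancel S.R)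
  inv_hom_id := GLCell.ext_R (neg_add_cancel S.R)

theorem _root_.GLCell.R_eqToHom {a b : GLObj V₁ V₀} {α β : a ⟶ b} (h : α = β) :
    GLCell.R (eqToHom h) = 0 := by
  subst h
  rfl

theorem _root_.GLCell.R_inv {a b : GLObj V₁ V₀} {α β : a ⟶ b} (e : α ≅ β) :
    GLCell.R e.inv = -GLCell.R e.hom := by
  have h : GLCell.R e.hom + GLCell.R e.inv = 0 := congrArg GLCell.R e.hom_inv_id
  exact (neg_eq_of_add_eq_zero_right h).symm

include F₁ in
theorem fiber_finiteDimensional [FiniteDimensional ℝ F₁] (x : M) : FiniteDimensional ℝ (V₁ x) :=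
  ((trivializationAt F₁ V₁ x).continuousLinearEquivAt ℝ x
    (FiberBundle.mem_baseSet_trivializationAt' x)).toLinearEquiv.symm.finiteDimensional

include F₁ in
theorem fiber_t2Space (x : M) : T2Space (V₁ x) :=
  ((trivializationAt F₁ V₁ x).continuousLinearEquivAt ℝ x
    (FiberBundle.mem_baseSet_trivializationAt' x)).toHomeomorph.symm.t2Space

/-- Arrows of `GL(V)` are quasi-isomorphisms, so they have homotopy inverses. -/
theorem invertibleUpToTwoCells [FiniteDimensional ℝ F₁] [FiniteDimensional ℝ F₀]
    {a b : GLObj V₁ V₀} (α : a ⟶ b) : InvertibleUpToTwoCells α := by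
  have := fiber_finiteDimensional (F₁ := F₁) (V₁ := V₁)
  have := fiber_finiteDimensional (F₁ := F₀) (V₁ := V₀)
  have := fiber_t2Space (F₁ := F₁) (V₁ := V₁)
  have := fiber_t2Space (F₁ := F₀) (V₁ := V₀)
  obtain ⟨β₁, β₀, R, S, hβ, hR, hR', hS, hS'⟩ :=
    (GLHom.quasiIso α).exists_homotopyInverse
  let β : GLHom b a := ⟨β₁, β₀, hβ, .of_homotopyInverse hβ (GLHom.comm α) hS hS' hR hR'⟩
  exact ⟨β, ⟨GLCell.toIso (α := GLHom.trans α β) (β := GLHom.refl a) ⟨R, hR, hR'⟩⟩,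
    ⟨GLCell.toIso (α := GLHom.trans β α) (β := GLHom.refl b) ⟨S, hS, hS'⟩⟩⟩

/-! ### Representations up to homotopy as pseudo-functors -/

namespace RepUpToHomotopy

variable (E : RepUpToHomotopy EM EG F₁ F₀ V₁ V₀)

/-- The complex `∂ : V₁ˣ → V₀ˣ` as an object of `GL(V)`. -/
def toGLObj (x : M) : GLObj V₁ V₀ := ⟨x, E.d x⟩

/-- The chain map `ρ^g` as an arrow of `GL(V)`. The map of the inverse arrow is a homotopy
inverse, by means of the homotopies `γ^{g⁻¹,g}` and `γ^{g,g⁻¹}`. -/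
def toGLHom {x y : M} (g : x ⟶ y) : GLHom (E.toGLObj x) (E.toGLObj y) where
  f₁ := E.ρ₁ g
  f₀ := E.ρ₀ g
  comm := E.ρ_d g
  quasiIso := by
    refine IsQuasiIso.of_homotopyInverse (β₁ := E.ρ₁ (Groupoid.inv g))
      (β₀ := E.ρ₀ (Groupoid.inv g)) (R := -E.γ g (Groupoid.inv g))
      (S := -E.γ (Groupoid.inv g) g) (E.ρ_d g) (E.ρ_d (Groupoid.inv g)) ?_ ?_ ?_ ?_
    · intro v
      change -(E.γ g (Groupoid.inv g) (E.d x v)) = _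
      rw [E.γ_d, Groupoid.comp_inv, E.ρ₁_id, ContinuousLinearMap.id_apply, neg_sub]
    · intro w
      change E.d x (-(E.γ g (Groupoid.inv g) w)) = _
      rw [map_neg, E.d_γ, Groupoid.comp_inv, E.ρ₀_id, ContinuousLinearMap.id_apply, neg_sub]
    · intro v
      change -(E.γ (Groupoid.inv g) g (E.d y v)) = _
      rw [E.γ_d, Groupoid.inv_comp, E.ρ₁_id, ContinuousLinearMap.id_apply, neg_sub]
    · intro w
      change E.d y (-(E.γ (Groupoid.inv g) g w)) = _
      rw [map_neg, E.d_γ, Groupoid.inv_comp, E.ρ₀_id, ContinuousLinearMap.id_apply, neg_sub]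

/-- The curvature `γ^{h,g}` as a 2-cell `ρ^{hg} ⇒ ρ^h ρ^g` of `GL(V)`. -/
def toGLCell {x y z : M} (g : x ⟶ y) (h : y ⟶ z) :
    GLCell (E.toGLHom (g ≫ h)) ((E.toGLHom g).trans (E.toGLHom h)) where
  R := E.γ g h
  R_d := E.γ_d g h
  d_R := E.d_γ g h

/-- The strictly unitary pseudo-functor `x ↦ ∂ˣ`, `g ↦ ρ^g`, with structure 2-cells `γ`, of a
normalized representation up to homotopy. -/
def toStrictlyUnitaryPseudofunctor (hE : ∀ x, E.γ (𝟙 x) (𝟙 x) = 0) :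
    StrictlyUnitaryPseudofunctor (LocallyDiscrete M) (GLObj V₁ V₀) :=
  have map_id (x : LocallyDiscrete M) : E.toGLHom (𝟙 x.as) = GLHom.refl (E.toGLObj x.as) :=
    GLHom.ext (E.ρ₁_id x.as) (E.ρ₀_id x.as)
  StrictlyUnitaryPseudofunctor.mk'
    { obj := fun x => E.toGLObj x.as
      map := fun g => E.toGLHom g.as
      map_id := map_id
      map₂ := fun η => GLCell.ofEq (congrArg (fun g => E.toGLHom g.as)
        (LocallyDiscrete.eq_of_hom η))
      map₂_id := fun _ => rfl
      map₂_comp := fun _ _ => GLCell.ext_R (add_zero _).symm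
      mapComp := fun g h => GLCell.toIso (E.toGLCell g.as h.as)
      map₂_whisker_left := fun {x y z} f g h η => by
        obtain rfl := LocallyDiscrete.eq_of_hom η
        refine GLCell.ext_R ?_
        change (0 : V₀ x.as →L[ℝ] V₁ z.as) = E.γ f.as g.as +
          ((0 : V₀ y.as →L[ℝ] V₁ z.as).comp (E.ρ₀ f.as) + -E.γ f.as g.as)
        simp
      map₂_whisker_right := fun {x y z} f g η h => by
        obtain rfl := LocallyDiscrete.eq_of_hom η
        refine GLCell.ext_R ?_
        change (0 : V₀ x.as →L[ℝ] V₁ z.as) = E.γ f.as h.as +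
          ((E.ρ₁ h.as).comp (0 : V₀ x.as →L[ℝ] V₁ y.as) + -E.γ f.as h.as)
        simp
      map₂_left_unitor := fun {x y} g => by
        refine GLCell.ext_R ?_
        -- `R` is the homotopy of the unit 2-cell, an `eqToHom`; it vanishes only propositionally
        have key (R : V₀ x.as →L[ℝ] V₁ y.as) (hR : R = 0) :
            (0 : V₀ x.as →L[ℝ] V₁ y.as) = E.γ (𝟙 x.as) g.as + (R + 0) := by
          ext w
          simp [hR, E.γ_id_left, hE]
        exact key _ (GLCell.R_eqToHom _)
      map₂_right_unitor := fun {x y} g => by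
        refine GLCell.ext_R ?_
        have key (R : V₀ x.as →L[ℝ] V₁ y.as) (hR : R = 0) :
            (0 : V₀ x.as →L[ℝ] V₁ y.as) = E.γ g.as (𝟙 y.as) + (R + 0) := by
          ext w
          simp [hR, E.γ_id_right, hE]
        exact key _ (GLCell.R_eqToHom _)
      map₂_associator := fun {x y z t} f g h => by
        refine GLCell.ext_R ?_
        change (0 : V₀ x.as →L[ℝ] V₁ t.as) = E.γ (f.as ≫ g.as) h.as +
          ((E.ρ₁ h.as).comp (E.γ f.as g.as) + (0 +
            ((-E.γ g.as h.as).comp (E.ρ₀ f.as) + -E.γ f.as (g.as ≫ h.as))))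
        ext w
        have e := E.cocycle f.as g.as h.as w
        simp only [add_apply, neg_apply, ContinuousLinearMap.comp_apply, zero_apply]
        linear_combination (norm := module) -e }

end RepUpToHomotopy

namespace RepUpToHomotopy

variable [IsLieGroupoid EM EG M] [FiniteDimensional ℝ F₁] [FiniteDimensional ℝ F₀]
  (E : RepUpToHomotopy EM EG F₁ F₀ V₁ V₀)

theorem contMDiff_objTotal :
    ContMDiff 𝓘(ℝ, EM) (objModel EM F₁ F₀) ∞ (fun x : M => objTotal F₁ F₀ (E.toGLObj x)) :=
  contMDiff_homSection_iff (A := V₁) (B := V₀) (T := E.d).2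
    (contMDiff_bundleMap_iff.1 E.smooth_d)

theorem contMDiff_homEmbed :
    ContMDiff 𝓘(ℝ, EG) (homModel EM F₁ F₀) ∞
      (fun g : Quiver.Total M => homEmbed F₁ F₀ (E.toGLHom g.hom)) := by
  have hs := (IsLieGroupoid.submersion_source (EM := EM) (EG := EG) (M := M)).contMDiff
  have ht := (IsLieGroupoid.submersion_target (EM := EM) (EG := EG) (M := M)).contMDiff
  exact (E.contMDiff_objTotal.comp hs).prodMk ((E.contMDiff_objTotal.comp ht).prodMk
    ((smoothAlong_id_iff.1 (E.smooth_ρ₁.smoothAlong_homMk (smoothAlong_id_iff.2 hs)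
      (smoothAlong_id_iff.2 ht))).prodMk
    (smoothAlong_id_iff.1 (E.smooth_ρ₀.smoothAlong_homMk (smoothAlong_id_iff.2 hs)
      (smoothAlong_id_iff.2 ht)))))

theorem smoothAlong_cellEmbed :
    SmoothAlong (𝓘(ℝ, EG).prod 𝓘(ℝ, EG))
      ((homModel EM F₁ F₀).prod ((homModel EM F₁ F₀).prod (cellModel EM F₁ F₀)))
      ComposablePair.incl
      (fun p : ComposablePair M =>
        (homEmbed F₁ F₀ (E.toGLHom p.fst), homEmbed F₁ F₀ (E.toGLHom p.snd),
          cellEmbed F₁ F₀ (E.toGLCell p.fst p.snd))) := by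
  have hs := (IsLieGroupoid.submersion_source (EM := EM) (EG := EG) (M := M)).contMDiff
  have ht := (IsLieGroupoid.submersion_target (EM := EM) (EG := EG) (M := M)).contMDiff
  refine SmoothAlong.prodMk (SmoothAlong.of_contMDiff ComposablePair.incl
    (E.contMDiff_homEmbed.comp contMDiff_fst)) (SmoothAlong.prodMk
    (SmoothAlong.of_contMDiff ComposablePair.incl (E.contMDiff_homEmbed.comp contMDiff_snd))
    (SmoothAlong.prodMk
      (SmoothAlong.postcomp (IsLieGroupoid.smooth_mul (EM := EM) (EG := EG) (M := M))
        E.contMDiff_homEmbed)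
      (E.smooth_γ.smoothAlong_homMk
        (SmoothAlong.of_contMDiff ComposablePair.incl (hs.comp contMDiff_fst))
        (SmoothAlong.of_contMDiff ComposablePair.incl (ht.comp contMDiff_snd)))))

/-- The smooth pseudo-functor of a normalized representation up to homotopy. -/
def toSmoothPseudofunctor (hE : E.IsNormalized) :
    SmoothPseudofunctor EM EG F₁ F₀ V₁ V₀ where
  toStrictlyUnitaryPseudofunctor := E.toStrictlyUnitaryPseudofunctor hE
  base_obj _ := rfl
  smooth_obj := E.contMDiff_objTotal
  smooth_map := E.contMDiff_homEmbed
  smooth_mapComp := E.smoothAlong_cellEmbed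

end RepUpToHomotopy

/-! ### Quasi-isomorphisms as lax equivalences -/

namespace RuthQuasiIso

variable [IsLieGroupoid EM EG M] {E E' : RepUpToHomotopy EM EG F₁ F₀ V₁ V₀}
  (S : RuthQuasiIso E E')

/-- The homotopy of a unit arrow vanishes for morphisms of normalized representations: this is
the coherence equation for the pair of units. -/
theorem μ_id (hE : E.IsNormalized) (hE' : E'.IsNormalized) (x : M) : S.μ (𝟙 x) = 0 := by
  ext w
  have h := S.coherence (𝟙 x) (𝟙 x) w
  rw [hE x, hE' x, E.ρ₀_id, E'.ρ₁_id, Category.id_comp] at h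
  simpa using h

/-- The component `θ^x` as an arrow of `GL(V)`. -/
def toGLHom (x : M) : GLHom (E.toGLObj x) (E'.toGLObj x) where
  f₁ := S.θ₁ x
  f₀ := S.θ₀ x
  comm := S.comm x
  quasiIso := S.quasiIso x

/-- The homotopy `μ^g` as a 2-cell `θ^y ρ^g ⇒ ρ'^g θ^x` of `GL(V)`. -/
def toGLCell {x y : M} (g : x ⟶ y) :
    GLCell ((E.toGLHom g).trans (S.toGLHom y)) ((S.toGLHom x).trans (E'.toGLHom g)) where
  R := S.μ g
  R_d := S.μ_d g
  d_R := S.d_μ g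

/-- The transformation between pseudo-functors given by a quasi-isomorphism of normalized
representations. -/
def toStrongTrans (hE : E.IsNormalized) (hE' : E'.IsNormalized) :
    Pseudofunctor.StrongTrans (E.toStrictlyUnitaryPseudofunctor hE).toPseudofunctor
      (E'.toStrictlyUnitaryPseudofunctor hE').toPseudofunctor where
  app x := S.toGLHom x.as
  naturality g := GLCell.toIso (S.toGLCell g.as)
  naturality_naturality {x y f g} η := by
    obtain rfl := LocallyDiscrete.eq_of_hom η
    refine GLCell.ext_R ?_
    change (S.θ₁ y.as).comp (0 : V₀ x.as →L[ℝ] V₁ y.as) + S.μ f.as =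
      S.μ f.as + (0 : V₀ x.as →L[ℝ] V₁ y.as).comp (S.θ₀ x.as)
    simp
  naturality_id x := by
    refine GLCell.ext_R ?_
    have key (R R' : V₀ x.as →L[ℝ] V₁ x.as) (hR : R = 0) (hR' : R' = 0) :
        S.μ (𝟙 x.as) + R.comp (S.θ₀ x.as) = (S.θ₁ x.as).comp R' + (0 + 0) := by
      rw [S.μ_id hE hE', hR, hR']
      simp
    exact key _ _ (GLCell.R_eqToHom ((E'.toStrictlyUnitaryPseudofunctor hE').map_id x))
      (GLCell.R_eqToHom ((E.toStrictlyUnitaryPseudofunctor hE).map_id x))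
  naturality_comp {x y z} f g := by
    refine GLCell.ext_R ?_
    change S.μ (f.as ≫ g.as) + (E'.γ f.as g.as).comp (S.θ₀ x.as) =
      (S.θ₁ z.as).comp (E.γ f.as g.as) + (0 + ((S.μ g.as).comp (E.ρ₀ f.as) + (0 +
        ((E'.ρ₁ g.as).comp (S.μ f.as) + 0))))
    ext w
    have e := S.coherence f.as g.as w
    simp only [add_apply, ContinuousLinearMap.comp_apply, zero_apply]
    linear_combination (norm := module) -e

variable [FiniteDimensional ℝ F₁] [FiniteDimensional ℝ F₀]

/-- The smooth lax equivalence given by a quasi-isomorphism of normalized representations. -/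
def toSmoothLaxEquivalence (hE : E.IsNormalized) (hE' : E'.IsNormalized) :
    SmoothLaxEquivalence (E.toSmoothPseudofunctor hE) (E'.toSmoothPseudofunctor hE') where
  trans := S.toStrongTrans hE hE'
  invertible_app _ := invertibleUpToTwoCells (F₁ := F₁) (F₀ := F₀) _
  smooth_app := E.contMDiff_objTotal.prodMk (E'.contMDiff_objTotal.prodMk
    ((contMDiff_bundleMap_iff.1 S.smooth_θ₁).prodMk (contMDiff_bundleMap_iff.1 S.smooth_θ₀)))
  smooth_naturality := by
    have hs := (IsLieGroupoid.submersion_source (EM := EM) (EG := EG) (M := M)).contMDiff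
    have ht := (IsLieGroupoid.submersion_target (EM := EM) (EG := EG) (M := M)).contMDiff
    have hθ₁ := (contMDiff_bundleMap_iff.1 S.smooth_θ₁).comp ht
    have hθ₀ := (contMDiff_bundleMap_iff.1 S.smooth_θ₀).comp ht
    have hρ := E.contMDiff_homEmbed
    exact ((E.contMDiff_objTotal.comp hs).prodMk ((E'.contMDiff_objTotal.comp ht).prodMk
      ((contMDiff_homMk_comp hρ.snd.snd.fst hθ₁).prodMk
        (contMDiff_homMk_comp hρ.snd.snd.snd hθ₀)))).prodMk
      (smoothAlong_id_iff.1 (S.smooth_μ.smoothAlong_homMk (smoothAlong_id_iff.2 hs)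
        (smoothAlong_id_iff.2 ht)))

/-- The quasi-isomorphism of representations given by a smooth lax equivalence between their
pseudo-functors. -/
def ofSmoothLaxEquivalence {hE : E.IsNormalized} {hE' : E'.IsNormalized}
    (H : SmoothLaxEquivalence (E.toSmoothPseudofunctor hE) (E'.toSmoothPseudofunctor hE')) :
    RuthQuasiIso E E' where
  θ₁ x := GLHom.f₁ (H.trans.app ⟨x⟩)
  θ₀ x := GLHom.f₀ (H.trans.app ⟨x⟩)
  μ g := GLCell.R (H.trans.naturality g.toLoc).hom
  comm x := GLHom.comm (H.trans.app ⟨x⟩)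
  quasiIso x := GLHom.quasiIso (H.trans.app ⟨x⟩)
  μ_d g := GLCell.R_d (H.trans.naturality g.toLoc).hom
  d_μ g := GLCell.d_R (H.trans.naturality g.toLoc).hom
  coherence {x y z} g h w := by
    have e := congrArg (fun S => GLCell.R S w) (H.trans.naturality_comp g.toLoc h.toLoc)
    let μ {x y : M} (g : x ⟶ y) : V₀ x →L[ℝ] V₁ y :=
      GLCell.R (H.trans.naturality g.toLoc).hom
    let θ₁ (x : M) : V₁ x →L[ℝ] V₁ x := GLHom.f₁ (H.trans.app ⟨x⟩)
    let θ₀ (x : M) : V₀ x →L[ℝ] V₀ x := GLHom.f₀ (H.trans.app ⟨x⟩)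
    replace e : μ (g ≫ h) w + E'.γ g h (θ₀ x w) = θ₁ z (E.γ g h w) + (0 +
      (μ h (E.ρ₀ g w) + (0 + (E'.ρ₁ h (μ g w) + 0)))) := e
    change θ₁ z (E.γ g h w) + μ h (E.ρ₀ g w) + E'.ρ₁ h (μ g w) - μ (g ≫ h) w -
      E'.γ g h (θ₀ x w) = 0
    linear_combination (norm := module) -e
  smooth_θ₁ := contMDiff_bundleMap_iff (A := V₁) (B := V₁)
    (T := fun x => GLHom.f₁ (H.trans.app ⟨x⟩)).2 H.smooth_app.snd.snd.fst
  smooth_θ₀ := contMDiff_bundleMap_iff (A := V₀) (B := V₀)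
    (T := fun x => GLHom.f₀ (H.trans.app ⟨x⟩)).2 H.smooth_app.snd.snd.snd
  smooth_μ := SmoothAlong.smoothFamily (smoothAlong_id_iff.2 H.smooth_naturality.snd)

end RuthQuasiIso

/-! ### The comparison functor -/

variable [IsLieGroupoid EM EG M] [FiniteDimensional ℝ F₁] [FiniteDimensional ℝ F₀]

variable (EM EG F₁ F₀ V₁ V₀) in
/-- The functor from normalized representations up to homotopy to smooth pseudo-functors. -/
def comparison :
    (RepUpToHomotopy.IsNormalized (EM := EM) (EG := EG) (F₁ := F₁) (F₀ := F₀) (V₁ := V₁)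
      (V₀ := V₀)).FullSubcategory ⥤ SmoothPseudofunctor EM EG F₁ F₀ V₁ V₀ where
  obj E := E.obj.toSmoothPseudofunctor E.property
  map {E E'} S := RuthQuasiIso.toSmoothLaxEquivalence S.hom E.property E'.property
  map_id E := SmoothLaxEquivalence.ext' (strongTrans_ext (fun _ => rfl) fun f =>
    (SmoothLaxEquivalence.id_naturality_R
      (F := (E.obj.toStrictlyUnitaryPseudofunctor E.property).toPseudofunctor) f).symm)
  map_comp {E E' E''} S T := SmoothLaxEquivalence.ext' (strongTrans_ext (fun _ => rfl) fun f =>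
    (SmoothLaxEquivalence.vcomp_naturality_R
      (RuthQuasiIso.toStrongTrans S.hom E.property E'.property)
      (RuthQuasiIso.toStrongTrans T.hom E'.property E''.property) f).symm)

instance : (comparison EM EG F₁ F₀ V₁ V₀).Faithful where
  map_injective {E E' S T} h := by
    have ht : RuthQuasiIso.toStrongTrans S.hom E.property E'.property =
        RuthQuasiIso.toStrongTrans T.hom E.property E'.property :=
      congrArg SmoothLaxEquivalence.trans h
    refine ObjectProperty.hom_ext _ (RuthQuasiIso.ext' ?_ ?_ ?_)
    · funext x
      exact congrArg (fun η => GLHom.f₁ (Pseudofunctor.StrongTrans.app η ⟨x⟩)) ht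
    · funext x
      exact congrArg (fun η => GLHom.f₀ (Pseudofunctor.StrongTrans.app η ⟨x⟩)) ht
    · intro x y g
      have key : ∀ {η θ : Pseudofunctor.StrongTrans
          (E.obj.toStrictlyUnitaryPseudofunctor E.property).toPseudofunctor
          (E'.obj.toStrictlyUnitaryPseudofunctor E'.property).toPseudofunctor}, η = θ →
          (GLCell.R (η.naturality g.toLoc).hom : V₀ x →L[ℝ] V₁ y) =
            GLCell.R (θ.naturality g.toLoc).hom := by
        rintro _ _ rfl
        rfl
      exact key ht

instance : (comparison EM EG F₁ F₀ V₁ V₀).Full where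
  map_surjective {E E'} H := by
    refine ⟨⟨RuthQuasiIso.ofSmoothLaxEquivalence H⟩, ?_⟩
    exact SmoothLaxEquivalence.ext' (strongTrans_ext (fun _ => rfl) fun f => rfl)

/-- A pseudo-functor on a groupoid with only identity 2-cells sends all 2-cells to identities. -/
theorem R_map₂ (F : PrelaxFunctor (LocallyDiscrete M) (GLObj V₁ V₀)) {a b : LocallyDiscrete M}
    {f g : a ⟶ b} (η : f ⟶ g) : GLCell.R (F.map₂ η) = 0 := by
  obtain rfl := LocallyDiscrete.eq_of_hom η
  rw [Subsingleton.elim η (𝟙 f), F.map₂_id]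
  rfl

/-- A strictly unitary pseudo-functor into `GL(V)` is determined by its values on objects and
arrows and by its structure 2-cells for composition. -/
theorem strictlyUnitaryPseudofunctor_ext
    {F G : StrictlyUnitaryPseudofunctor (LocallyDiscrete M) (GLObj V₁ V₀)}
    (hobj : F.obj = G.obj)
    (hmap : ∀ {a b : LocallyDiscrete M} (f : a ⟶ b), HEq (F.map f) (G.map f))
    (hR : ∀ {a b c : LocallyDiscrete M} (f : a ⟶ b) (g : b ⟶ c),
      HEq (GLCell.R (F.mapComp f g).hom) (GLCell.R (G.mapComp f g).hom)) : F = G := by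
  have hF {a b : LocallyDiscrete M} {f g : a ⟶ b} (η : f ⟶ g) := R_map₂ F.toPrelaxFunctor η
  have hG {a b : LocallyDiscrete M} {f g : a ⟶ b} (η : f ⟶ g) := R_map₂ G.toPrelaxFunctor η
  obtain ⟨⟨⟨⟨⟨obj, map⟩, map₂⟩, _, _⟩, mapId, mapComp, _, _, _, _, _⟩, map_id, hmapId⟩ := F
  obtain ⟨⟨⟨⟨⟨obj', map'⟩, map₂'⟩, _, _⟩, mapId', mapComp', _, _, _, _, _⟩, map_id', hmapId'⟩ := G
  dsimp only at hobj hmap hR hF hG hmapId hmapId'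
  subst hobj
  obtain rfl : @map = @map' := by
    funext a b f
    exact eq_of_heq (hmap f)
  obtain rfl : @map₂ = @map₂' := by
    funext a b f g η
    exact GLCell.ext_R ((hF η).trans (hG η).symm)
  obtain rfl : mapId = mapId' := by
    funext a
    rw [hmapId, hmapId']
  obtain rfl : @mapComp = @mapComp' := by
    funext a b c f g
    exact Iso.ext (GLCell.ext_R (eq_of_heq (hR f g)))
  rfl

theorem exists_eq_of_base_eq {obj : LocallyDiscrete M → GLObj V₁ V₀}
    (h : ∀ x : M, (obj ⟨x⟩).base = x) :
    ∃ d : ∀ x, V₁ x →L[ℝ] V₀ x, obj = fun x => ⟨x.as, d x.as⟩ := by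
  have key (a : GLObj V₁ V₀) (x : M) (e : a.base = x) : ∃ d : V₁ x →L[ℝ] V₀ x, a = ⟨x, d⟩ := by
    subst e
    exact ⟨a.d, rfl⟩
  choose d hd using fun x => key (obj ⟨x⟩) x (h x)
  exact ⟨d, funext fun x => hd x.as⟩

/-- Every smooth pseudo-functor over `Pair(M)` is the pseudo-functor of the representation with
`∂`, `ρ` and `γ` read off from its values on objects, its values on arrows and its structure
2-cells. -/
instance : (comparison EM EG F₁ F₀ V₁ V₀).EssSurj where
  mem_essImage φ := by
    have map₂_zero {a b : LocallyDiscrete M} {f g : a ⟶ b} (η : f ⟶ g) :=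
      R_map₂ φ.toPrelaxFunctor η
    have assoc {a b c d : LocallyDiscrete M} (f : a ⟶ b) (g : b ⟶ c) (h : c ⟶ d) :=
      congrArg GLCell.R (φ.map₂_associator f g h)
    have unit (a : LocallyDiscrete M) := congrArg GLCell.R (φ.map₂_left_unitor (𝟙 a))
    have R_mapComp_inv {a b c : LocallyDiscrete M} (f : a ⟶ b) (g : b ⟶ c) :=
      GLCell.R_inv (φ.mapComp f g)
    have R_mapId (a : LocallyDiscrete M) : GLCell.R (φ.mapId a).hom = 0 := by
      rw [φ.mapId_eq_eqToIso]
      exact GLCell.R_eqToHom (φ.map_id a)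
    obtain ⟨F, base, so, sm, sc⟩ := φ
    obtain ⟨⟨⟨⟨⟨obj, map⟩, map₂⟩, _, _⟩, mapId, mapComp, _, _, _, _, _⟩, map_id, hmapId⟩ := F
    dsimp only at *
    obtain ⟨d, rfl⟩ := exists_eq_of_base_eq base
    let E : RepUpToHomotopy EM EG F₁ F₀ V₁ V₀ :=
      { d := d
        ρ₁ := fun g => GLHom.f₁ (map g.toLoc)
        ρ₀ := fun g => GLHom.f₀ (map g.toLoc)
        γ := fun g h => GLCell.R (mapComp g.toLoc h.toLoc).hom
        ρ₁_id := fun x => congrArg GLHom.f₁ (map_id ⟨x⟩)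
        ρ₀_id := fun x => congrArg GLHom.f₀ (map_id ⟨x⟩)
        ρ_d := fun g => GLHom.comm (map g.toLoc)
        γ_d := fun g h => GLCell.R_d (mapComp g.toLoc h.toLoc).hom
        d_γ := fun g h => GLCell.d_R (mapComp g.toLoc h.toLoc).hom
        cocycle := fun {x y z t} g₁ g₂ g₃ w => by
          let γ {x y z : M} (g : x ⟶ y) (h : y ⟶ z) : V₀ x →L[ℝ] V₁ z :=
            GLCell.R (mapComp g.toLoc h.toLoc).hom
          let ρ₁ {x y : M} (g : x ⟶ y) : V₁ x →L[ℝ] V₁ y := GLHom.f₁ (map g.toLoc)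
          let ρ₀ {x y : M} (g : x ⟶ y) : V₀ x →L[ℝ] V₀ y := GLHom.f₀ (map g.toLoc)
          have key (R S S' : V₀ x →L[ℝ] V₁ t) (S'' : V₀ y →L[ℝ] V₁ t) (hR : R = 0)
              (hS : S' = -γ g₁ (g₂ ≫ g₃)) (hS'' : S'' = -γ g₂ g₃)
              (e : R = γ (g₁ ≫ g₂) g₃ + ((ρ₁ g₃).comp (γ g₁ g₂) + (0 +
                (S''.comp (ρ₀ g₁) + S')))) :
              ρ₁ g₃ (γ g₁ g₂ w) - γ g₁ (g₂ ≫ g₃) w + γ (g₁ ≫ g₂) g₃ w -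
                γ g₂ g₃ (ρ₀ g₁ w) = 0 := by
            have e' := DFunLike.congr_fun e w
            rw [hR, hS, hS''] at e'
            simp only [add_apply, neg_apply, ContinuousLinearMap.comp_apply, zero_apply] at e'
            linear_combination (norm := module) -e'
          exact key _ 0 _ _ (map₂_zero _) (R_mapComp_inv _ _) (R_mapComp_inv _ _)
            (assoc g₁.toLoc g₂.toLoc g₃.toLoc)
        smooth_d := contMDiff_bundleMap_iff.2 (contMDiff_homSection_iff.1 so)
        smooth_ρ₁ := SmoothAlong.smoothFamily (smoothAlong_id_iff.2 sm.snd.snd.fst)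
        smooth_ρ₀ := SmoothAlong.smoothFamily (smoothAlong_id_iff.2 sm.snd.snd.snd)
        smooth_γ := SmoothAlong.smoothFamily
          (sc.postcomp (contMDiff_snd.comp (contMDiff_snd.comp contMDiff_snd))) }
    have hE : E.IsNormalized := by
      intro x
      have key (R R' : V₀ x →L[ℝ] V₁ x) (hR : R = 0) (hR' : R' = 0)
          (e : R = E.γ (𝟙 x) (𝟙 x) + ((E.ρ₁ (𝟙 x)).comp R' + 0)) : E.γ (𝟙 x) (𝟙 x) = 0 := by
        rw [hR, hR', ContinuousLinearMap.comp_zero, add_zero, add_zero] at e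
        exact e.symm
      exact key _ _ (map₂_zero _) (R_mapId ⟨x⟩) (unit ⟨x⟩)
    refine ⟨⟨E, hE⟩, ⟨eqToIso ?_⟩⟩
    have h : E.toStrictlyUnitaryPseudofunctor hE = _ :=
      strictlyUnitaryPseudofunctor_ext (G := ⟨⟨⟨⟨⟨fun x => ⟨x.as, d x.as⟩, map⟩, map₂⟩, _, _⟩,
        mapId, mapComp, _, _, _, _, _⟩, map_id, hmapId⟩) rfl (fun _ => HEq.rfl)
        (fun _ _ => HEq.rfl)
    change SmoothPseudofunctor.mk (E.toStrictlyUnitaryPseudofunctor hE) _ _ _ _ = _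
    congr 1

end Comparison

end TwoTerm

theorem theorem7 (EM EG F₁ F₀ : Type*) {M : Type*}
    [NormedAddCommGroup EM] [NormedSpace ℝ EM] [FiniteDimensional ℝ EM]
    [NormedAddCommGroup EG] [NormedSpace ℝ EG] [FiniteDimensional ℝ EG]
    -- the Lie groupoid `G ⇉ M`
    [Groupoid M] [TopologicalSpace M] [ChartedSpace EM M]
    [TopologicalSpace (Quiver.Total M)] [ChartedSpace EG (Quiver.Total M)]
    [IsLieGroupoid EM EG M]
    -- the smooth vector bundle `V₁ → M`
    [NormedAddCommGroup F₁] [NormedSpace ℝ F₁] [FiniteDimensional ℝ F₁]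
    (V₁ : M → Type*) [∀ x, AddCommGroup (V₁ x)] [∀ x, Module ℝ (V₁ x)]
    [∀ x, TopologicalSpace (V₁ x)] [∀ x, IsTopologicalAddGroup (V₁ x)]
    [∀ x, ContinuousSMul ℝ (V₁ x)]
    [TopologicalSpace (TotalSpace F₁ V₁)] [FiberBundle F₁ V₁] [VectorBundle ℝ F₁ V₁]
    [ContMDiffVectorBundle ∞ F₁ V₁ 𝓘(ℝ, EM)]
    -- the smooth vector bundle `V₀ → M`
    [NormedAddCommGroup F₀] [NormedSpace ℝ F₀] [FiniteDimensional ℝ F₀]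
    (V₀ : M → Type*) [∀ x, AddCommGroup (V₀ x)] [∀ x, Module ℝ (V₀ x)]
    [∀ x, TopologicalSpace (V₀ x)] [∀ x, IsTopologicalAddGroup (V₀ x)]
    [∀ x, ContinuousSMul ℝ (V₀ x)]
    [TopologicalSpace (TotalSpace F₀ V₀)] [FiberBundle F₀ V₀] [VectorBundle ℝ F₀ V₀]
    [ContMDiffVectorBundle ∞ F₀ V₀ 𝓘(ℝ, EM)] :
    Nonempty (TwoTerm.RepUpToHomotopy EM EG F₁ F₀ V₁ V₀ ≌
      TwoTerm.SmoothPseudofunctor EM EG F₁ F₀ V₁ V₀) := by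
  have : (TwoTerm.RepUpToHomotopy.IsNormalized (EM := EM) (EG := EG) (F₁ := F₁) (F₀ := F₀)
      (V₁ := V₁) (V₀ := V₀)).ι.IsEquivalence := {}
  have : (TwoTerm.comparison EM EG F₁ F₀ V₁ V₀).IsEquivalence := {}
  exact ⟨(TwoTerm.RepUpToHomotopy.IsNormalized.ι.asEquivalence).symm.trans
    (TwoTerm.comparison EM EG F₁ F₀ V₁ V₀).asEquivalence⟩
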